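/- **Setting.** For $n\in\mathbb N$, $p\in(0,1)$ and $\rho\in(0,1]$, let $\mathcal P_0=\mathcal P_0^{(n)}$ be the law of two independent Erdős–Rényi graphs $G_1,G_2\sim\mathcal G(n,p)$ on the vertex set $[n]$. Let $\mathcal P_1=\mathcal P_1^{(n)}$ be the law of the correlated pair $(G_1,G_2)\sim\mathcal G(n,p,\rho)$: a latent permutation $\pi$ of $[n]$ is drawn uniformly at random and, given $\pi$, the pairs $(\mathbf 1\{uv\in E(G_1)\},\mathbf 1\{\pi(u)\pi(v)\in E(G_2)\})$ are independent over the unordered pairs $u\ne v$, each being bivariate Bernoulli with both marginals Bernoulli$(p)$ and correlation coefficient $\rho$. A motif $\mathsf M$ is a finite simple graph with $\mathsf v(\mathsf M)$ vertices and $\mathsf e(\mathsf M)$ edges; a motif family $\mathcal M$ is a finite set of pairwise non-isomorphic motifs. With $\beta_{uv}(\bar G)=\mathbf 1\{uv\in E(G)\}-p$, put $$\mathsf{inj}(\mathsf M,\bar G)=\sum_{\varphi:V(\mathsf M)\to[n]\ \text{injective}}\ \prod_{uv\in E(\mathsf M)}\beta_{\varphi(u)\varphi(v)}(\bar G),\qquad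 \mathcal T_{\mathcal M}(G_1,G_2)=\sum_{\mathsf M\in\mathcal M}\omega_{\mathsf M}\,\mathsf{inj}(\mathsf M,\bar G_1)\,\mathsf{inj}(\mathsf M,\bar G_2),$$ where $\omega_{\mathsf M}\in\mathbb R$ are weights. Let $p=p_n$, $\rho=\rho_n\in(0,1]$, $C=C_n\in\mathbb R$ and $\mathcal M=\mathcal M_n$ depend on $n$, with $0<p_n\le 1-\delta$ for all $n$ and some constant $\delta>0$. The motif family $\mathcal M$ is called $C$-admissible if $C=o\!\left(\frac{\log n}{\max(\log\log n,\,-\log\rho)}\right)$ as $n\to\infty$ and there is a constant $\epsilon_0>0$, independent of $n$, such that for all sufficiently large $n$: 1. every $\mathsf M\in\mathcal M$ is connected; 2. $\max(\mathsf v(\mathsf M),\mathsf e(\mathsf M))\le C$ for every $\mathsf M\in\mathcal M$; 3. $\sum_{\mathsf M\in\mathcal M}\rho^{2\mathsf e(\mathsf M)}\ge 400$; 4. $n^{\mathsf v(\mathsf M')}p^{\mathsf e(\mathsf M')}\ge n^{\epsilon_0}$ for every $\mathsf M\in\mathcal M$ and every subgraph $\mathsf M'\subseteq\mathsf M$ with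 at least one vertex. **Theorem.** If $\mathcal M$ is $C$-admissible, then for all sufficiently large $n$ there exist weights $\omega_{\mathsf M}\in\mathbb R$ $(\mathsf M\in\mathcal M)$ and a threshold $\tau\in\mathbb R$ such that $$\mathcal P_0(\mathcal T_{\mathcal M}\ge\tau)+\mathcal P_1(\mathcal T_{\mathcal M}<\tau)\le 0.05 .$$ -/

import Mathlib

open MeasureTheory Filter unitInterval
open scoped ENNReal

namespace MotifTest

/-! ### The two hypotheses -/

/-- The law of `(G₁, G₂)` under the null hypothesis: two independent Erdős–Rényi graphs
`𝒢(n, p)` on the vertex set `Fin n`. -/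
noncomputable def nullLaw (n : ℕ) (p : I) : Measure (SimpleGraph (Fin n) × SimpleGraph (Fin n)) :=
  (SimpleGraph.binomialRandom (Fin n) p).prod (SimpleGraph.binomialRandom (Fin n) p)

/-- The bivariate Bernoulli law with both marginals Bernoulli(`p`) and correlation
coefficient `ρ`. -/
noncomputable def correlatedBernoulli (p ρ : I) : Measure (Bool × Bool) :=
  ENNReal.ofReal ((p : ℝ) ^ 2 + ρ * (p * (1 - p))) • Measure.dirac (true, true)
    + ENNReal.ofReal ((1 - ρ) * (p * (1 - p))) • Measure.dirac (true, false)
    + ENNReal.ofReal ((1 - ρ) * (p * (1 - p))) • Measure.dirac (false, true)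
    + ENNReal.ofReal ((1 - (p : ℝ)) ^ 2 + ρ * (p * (1 - p))) • Measure.dirac (false, false)

/-- The pair of graphs built from one pair of bits `x e` for each unordered pair of vertices `e`:
`e` is an edge of the first graph iff the first bit is set, and `π(e)` is an edge of the second
graph iff the second bit is set. (`SimpleGraph.fromEdgeSet` discards the loops `s(u, u)`.) -/
def graphPair {n : ℕ} (π : Equiv.Perm (Fin n)) (x : Sym2 (Fin n) → Bool × Bool) :
    SimpleGraph (Fin n) × SimpleGraph (Fin n) :=
  (SimpleGraph.fromEdgeSet {e | (x e).1 = true},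
    (SimpleGraph.fromEdgeSet {e | (x e).2 = true}).map π)

/-- The law of `(G₁, G₂)` under the alternative conditionally on the latent bijection `π`: the
pairs of indicators of `(uv, π(u)π(v))` are independent over the unordered pairs `uv`, each one
correlated bivariate Bernoulli. -/
noncomputable def altLawGiven {n : ℕ} (p ρ : I) (π : Equiv.Perm (Fin n)) :
    Measure (SimpleGraph (Fin n) × SimpleGraph (Fin n)) :=
  (Measure.pi fun _ : Sym2 (Fin n) => correlatedBernoulli p ρ).map (graphPair π)

/-- The law of `(G₁, G₂)` under the alternative hypothesis: the correlated Erdős–Rényi graph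
`𝒢(n, p, ρ)`, with a uniformly random latent bijection. -/
noncomputable def altLaw (n : ℕ) (p ρ : I) :
    Measure (SimpleGraph (Fin n) × SimpleGraph (Fin n)) :=
  (Fintype.card (Equiv.Perm (Fin n)) : ℝ≥0∞)⁻¹ • ∑ π : Equiv.Perm (Fin n), altLawGiven p ρ π

/-! ### Motifs and the test statistic -/

/-- A motif: a finite simple graph, on the vertex set `Fin v`. -/
structure Motif where
  /-- the number of vertices -/
  v : ℕ
  /-- the graph -/
  graph : SimpleGraph (Fin v)

/-- The number of edges of a motif. -/
noncomputable def Motif.e (M : Motif) : ℕ := M.graph.edgeSet.ncard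

/-- A motif family is a finite set of motifs up to isomorphism: no two distinct members are
isomorphic. -/
def IsMotifFamily (F : Finset Motif) : Prop :=
  ∀ M ∈ F, ∀ N ∈ F, Nonempty (M.graph ≃g N.graph) → M = N

open Classical in
/-- The centered weights `β_{uv}(Ḡ) = 1{uv ∈ E(G)} - p` of a graph. -/
noncomputable def centered {n : ℕ} (p : I) (G : SimpleGraph (Fin n)) (e : Sym2 (Fin n)) : ℝ :=
  (if e ∈ G.edgeSet then 1 else 0) - p

open Classical in
/-- `inj(M, G)` for a weighted graph `G` with edge weights `β`: the sum over all injective maps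
`φ` of the vertices of `M` of the product of `β_{φ(u)φ(v)}` over the edges `uv` of `M`. -/
noncomputable def injCount {n : ℕ} (M : Motif) (β : Sym2 (Fin n) → ℝ) : ℝ :=
  ∑ φ : Fin M.v ↪ Fin n, ∏ e ∈ M.graph.edgeFinset, β (e.map φ)

/-- The motif counting statistic `𝒯(G₁, G₂) = ∑_M ω_M inj(M, Ḡ₁) inj(M, Ḡ₂)`. -/
noncomputable def statistic {n : ℕ} (p : I) (F : Finset Motif) (ω : Motif → ℝ)
    (G : SimpleGraph (Fin n) × SimpleGraph (Fin n)) : ℝ :=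
  ∑ M ∈ F, ω M * injCount M (centered p G.1) * injCount M (centered p G.2)

/-! ### Admissibility -/

/-- The conditions of admissibility at a given `n`, with size bound `C` and exponent `ε₀`. -/
structure IsAdmissibleAt (n : ℕ) (p ρ : I) (C ε₀ : ℝ) (F : Finset Motif) : Prop where
  connected : ∀ M ∈ F, M.graph.Connected
  size_le : ∀ M ∈ F, (M.v : ℝ) ≤ C ∧ (M.e : ℝ) ≤ C
  signal : 400 ≤ ∑ M ∈ F, (ρ : ℝ) ^ (2 * M.e)
  subgraph : ∀ M ∈ F, ∀ M' : M.graph.Subgraph, M'.verts.Nonempty →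
    (n : ℝ) ^ ε₀ ≤ (n : ℝ) ^ M'.verts.ncard * (p : ℝ) ^ M'.edgeSet.ncard

/-- `C`-admissibility of a sequence of motif families `F n`, for parameters `p n`, `ρ n` and size
bounds `C n`: `C = o(log n / max(log log n, -log ρ))`, and the other conditions hold for all large
`n` with a constant `ε₀ > 0` that does not depend on `n`. -/
def IsAdmissible (p ρ : ℕ → I) (C : ℕ → ℝ) (F : ℕ → Finset Motif) : Prop :=
  C =o[atTop] (fun n : ℕ =>
      Real.log n / max (Real.log (Real.log n)) (-Real.log (ρ n))) ∧
    ∃ ε₀ : ℝ, 0 < ε₀ ∧ ∀ᶠ n in atTop, IsAdmissibleAt n (p n) (ρ n) (C n) ε₀ (F n)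

end MotifTest

namespace MotifTest

/-! The proof is a second-moment argument. Write `s = p(1-p)` and let `B_M = coincidences n M M`
count the pairs of embeddings of `M` with the same edge image. Products of centered edge indicators
are orthogonal under the null law, so `inj(M)` has second moment `B_M s^e`, and non-isomorphic
motifs are uncorrelated. With `ω_M = ρ^e / (B_M s^e)` the statistic has null second moment `S = ∑
ρ^(2e)`, which is also its mean under the alternative. Relabelling a graph does not change `inj`, so
the latent permutation may be taken to be the identity. It remains to bound the second moment under
the alternative by `(1 + η) S² + 2 S`; Chebyshev at the threshold `S/2` then concludes (`error_le`).

That second moment is a sum over quadruples: copies of `M` and `N` in each graph. A quadruple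
contributes only if each of its edges is covered at least twice. If no vertex lies in three copies,
connectedness forces the copies to coincide in pairs (`pairing_of_isCovering`). Matching equal
motifs across the graphs gives `S²`; the other two pairings occur only for `M = N` and give at most
`2 S`.

If a vertex lies in three copies, double counting expresses the edges and vertices of the union
through those of the triple intersections. These are subgraphs of a copy of `M`, so the density
condition gains a factor `n^(ε/2)`, up to `δ^K` (`weight_le_of_hasTriple`). The number of ways to
overlap is at most factorial in the motif size (`sum_inv_pow_card_image_le`). The growth condition
on `C` makes all losses a small power of `n` (`eventually_size_bounds`). -/

instance measurableSingletonClass_simpleGraph (n : ℕ) :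
    MeasurableSingletonClass (SimpleGraph (Fin n)) where
  measurableSet_singleton G := by
    -- The σ-algebra on graphs is transported from edge sets. Once singletons are measurable, every
    -- real function of the graphs is integrable against a finite measure.
    have h := SimpleGraph.measurableEmbedding_edgeSet (V := Fin n)
    rw [← h.measurableSet_image, Set.image_singleton]
    exact measurableSet_singleton _

/-! ### Copies of motifs and products of centered edges -/

open Classical in
/-- The edge set of the copy `φ(M)` of a motif. -/
noncomputable def edgeImage {n : ℕ} (M : Motif) (φ : Fin M.v ↪ Fin n) : Finset (Sym2 (Fin n)) :=
  M.graph.edgeFinset.map φ.sym2Map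

/-- The product of the centered edge indicators over a set of edges. -/
noncomputable def character {n : ℕ} (p : I) (A : Finset (Sym2 (Fin n)))
    (G : SimpleGraph (Fin n)) : ℝ :=
  ∏ e ∈ A, centered p G e

lemma card_edgeImage {n : ℕ} (M : Motif) (φ : Fin M.v ↪ Fin n) : (edgeImage M φ).card = M.e := by
  classical
  rw [edgeImage, Finset.card_map, Motif.e, ← SimpleGraph.coe_edgeFinset, Set.ncard_coe_finset]

lemma mem_edgeImage {n : ℕ} {M : Motif} {φ : Fin M.v ↪ Fin n} {e : Sym2 (Fin n)} :
    e ∈ edgeImage M φ ↔ ∃ a b, M.graph.Adj a b ∧ e = s(φ a, φ b) := by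
  classical
  simp only [edgeImage, Finset.mem_map, SimpleGraph.mem_edgeFinset, Sym2.exists,
    SimpleGraph.mem_edgeSet, Function.Embedding.sym2Map_apply, Sym2.map_mk]
  grind

lemma mk_mem_edgeImage {n : ℕ} {M : Motif} {φ : Fin M.v ↪ Fin n} {a b : Fin M.v} :
    s(φ a, φ b) ∈ edgeImage M φ ↔ M.graph.Adj a b := by
  rw [mem_edgeImage]
  constructor
  · rintro ⟨c, d, h, he⟩
    rcases Sym2.eq_iff.1 he with ⟨h1, h2⟩ | ⟨h1, h2⟩
    · rwa [φ.injective h1, φ.injective h2]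
    · rw [φ.injective h1, φ.injective h2]; exact h.symm
  · exact fun h => ⟨a, b, h, rfl⟩

lemma not_isDiag_of_mem_edgeImage {n : ℕ} {M : Motif} {φ : Fin M.v ↪ Fin n} {e : Sym2 (Fin n)}
    (he : e ∈ edgeImage M φ) : ¬ e.IsDiag := by
  obtain ⟨a, b, h, rfl⟩ := mem_edgeImage.1 he
  simpa using h.ne

lemma injCount_centered {n : ℕ} (p : I) (M : Motif) (G : SimpleGraph (Fin n)) :
    injCount M (centered p G) = ∑ φ : Fin M.v ↪ Fin n, character p (edgeImage M φ) G := by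
  classical
  simp only [injCount, character, edgeImage, Finset.prod_map, Function.Embedding.sym2Map_apply]

lemma centered_map {n : ℕ} (p : I) (π : Equiv.Perm (Fin n)) (G : SimpleGraph (Fin n))
    (e : Sym2 (Fin n)) : centered p (G.map π) (e.map π) = centered p G e := by
  have h : e.map π ∈ (G.map π).edgeSet ↔ e ∈ G.edgeSet := by
    induction e with
    | _ a b =>
      simp only [Sym2.map_mk, SimpleGraph.mem_edgeSet]
      exact (SimpleGraph.map_adj_apply (f := π.toEmbedding))
  unfold centered
  by_cases he : e ∈ G.edgeSet
  · rw [if_pos he, if_pos (h.2 he)]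
  · rw [if_neg he, if_neg (mt h.1 he)]

/-- The substitution `φ ↦ π ∘ φ` absorbs the relabelling. This is what removes the latent
permutation from the problem. -/
lemma injCount_map {n : ℕ} (p : I) (M : Motif) (π : Equiv.Perm (Fin n))
    (G : SimpleGraph (Fin n)) :
    injCount M (centered p (G.map π)) = injCount M (centered p G) := by
  classical
  unfold injCount
  symm
  refine Fintype.sum_equiv (Equiv.embeddingCongr (Equiv.refl _) π) _ _ fun φ => ?_
  refine Finset.prod_congr rfl fun e _ => ?_
  rw [← centered_map p π, Sym2.map_map]
  rfl

/-- With exponents 0 or 1 all characters share one index set, so their products can be integrated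
edge by edge. -/
lemma character_eq_prod_univ {n : ℕ} (p : I) (A : Finset (Sym2 (Fin n)))
    (G : SimpleGraph (Fin n)) :
    character p A G = ∏ e, centered p G e ^ (if e ∈ A then 1 else 0) := by
  simp [character, pow_ite, Finset.prod_ite_mem]

/-! ### Moments under the null hypothesis -/

/-- The probability that a fixed potential edge is present, as a measure on `Prop`. -/
noncomputable def edgeLaw {n : ℕ} (p : I) (e : Sym2 (Fin n)) : Measure Prop :=
  toNNReal p • Measure.dirac (e ∈ (Sym2.diagSet : Set (Sym2 (Fin n)))ᶜ)
    + toNNReal (σ p) • Measure.dirac False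

instance isProbabilityMeasure_edgeLaw {n : ℕ} (p : I) (e : Sym2 (Fin n)) :
    IsProbabilityMeasure (edgeLaw p e) := by
  constructor
  simp only [edgeLaw, measure_univ]

/-- Reduces to independent bits, where expectations factorise. `edgeLaw` is spelled as the factor of
`setBernoulli`, so the last step is `rfl`. -/
lemma integral_binomialRandom {n : ℕ} (p : I) (f : SimpleGraph (Fin n) → ℝ) :
    ∫ G, f G ∂SimpleGraph.binomialRandom (Fin n) p
      = ∫ P, f (SimpleGraph.fromEdgeSet {e | P e}) ∂Measure.pi (edgeLaw (n := n) p) := by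
  rw [SimpleGraph.binomialRandom_eq_map, ProbabilityTheory.setBernoulli_eq_map,
    integral_map SimpleGraph.measurable_fromEdgeSet.aemeasurable
      (measurable_of_finite _).aestronglyMeasurable,
    integral_map (measurable_of_finite _).aemeasurable
      (measurable_of_finite _).aestronglyMeasurable]
  rw [← Measure.infinitePi_eq_pi]
  rfl

lemma integral_edgeLaw {n : ℕ} (p : I) {e : Sym2 (Fin n)} (he : ¬ e.IsDiag) (f : Prop → ℝ) :
    ∫ P, f P ∂edgeLaw p e = p * f True + (1 - p) * f False := by
  have h : (e ∈ (Sym2.diagSet : Set (Sym2 (Fin n)))ᶜ) = True := by simpa using he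
  rw [edgeLaw, h, integral_add_measure Integrable.of_finite Integrable.of_finite,
    integral_smul_nnreal_measure, integral_smul_nnreal_measure, integral_dirac, integral_dirac]
  simp [NNReal.smul_def]

lemma prod_pow_mem_eq {ι : Type*} [Fintype ι] [DecidableEq ι] {c : ℝ} (A : Finset ι) :
    ∏ e, (if e ∈ A then c else 1) = c ^ A.card := by
  simp [Finset.prod_ite_mem]

/-- Orthogonality: an edge in exactly one set has a factor of mean zero, an edge in both gives a
variance. Loops are excluded because their indicator is constant. -/
lemma integral_character_mul {n : ℕ} (p : I) {A B : Finset (Sym2 (Fin n))}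
    (hA : ∀ e ∈ A, ¬ e.IsDiag) (hB : ∀ e ∈ B, ¬ e.IsDiag) :
    ∫ G, character p A G * character p B G ∂SimpleGraph.binomialRandom (Fin n) p
      = if A = B then ((p : ℝ) * (1 - p)) ^ A.card else 0 := by
  classical
  rw [integral_binomialRandom]
  have key : ∀ P : Sym2 (Fin n) → Prop,
      character p A (SimpleGraph.fromEdgeSet {e | P e})
        * character p B (SimpleGraph.fromEdgeSet {e | P e})
      = ∏ e, ((if P e then (1 : ℝ) else 0) - p)
          ^ ((if e ∈ A then 1 else 0) + (if e ∈ B then 1 else 0)) := by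
    intro P
    rw [character_eq_prod_univ, character_eq_prod_univ, ← Finset.prod_mul_distrib]
    refine Finset.prod_congr rfl fun e _ => ?_
    rw [← pow_add]
    by_cases hd : e.IsDiag
    · have h1 : e ∉ A := fun h => hA e h hd
      have h2 : e ∉ B := fun h => hB e h hd
      simp [h1, h2]
    · simp [centered, hd]
  simp only [key]
  rw [integral_fintype_prod_eq_prod (𝕜 := ℝ) (E := fun _ => Prop)
    (fun e (P : Prop) => ((if P then (1 : ℝ) else 0) - p)
      ^ ((if e ∈ A then 1 else 0) + (if e ∈ B then 1 else 0)))]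
  have val : ∀ e, ∫ P, ((if P then (1 : ℝ) else 0) - p)
      ^ ((if e ∈ A then 1 else 0) + (if e ∈ B then 1 else 0)) ∂edgeLaw p e
      = if e ∈ A then (if e ∈ B then (p : ℝ) * (1 - p) else 0) else if e ∈ B then 0 else 1 := by
    intro e
    by_cases h1 : e ∈ A
    · rw [integral_edgeLaw p (hA e h1)]
      by_cases h2 : e ∈ B
      · simp only [h1, h2, if_true, if_false]; ring
      · simp only [h1, h2, if_true, if_false]; ring
    · by_cases h2 : e ∈ B
      · rw [integral_edgeLaw p (hB e h2)]
        simp only [h1, h2, if_true, if_false]; ring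
      · simp [h1, h2]
  simp only [val]
  split_ifs with hAB
  · subst hAB
    rw [← prod_pow_mem_eq]
    exact Finset.prod_congr rfl fun e _ => by split_ifs <;> rfl
  · obtain ⟨e, he⟩ : ∃ e, ¬ (e ∈ A ↔ e ∈ B) := by
      by_contra! h
      exact hAB (Finset.ext h)
    refine Finset.prod_eq_zero (Finset.mem_univ e) ?_
    by_cases h1 : e ∈ A <;> by_cases h2 : e ∈ B <;> simp_all

/-! ### Moments under the alternative -/

/-- The mixed moment `E[(X - p)ⁱ (Y - p)ʲ]` of a correlated pair of Bernoulli variables. -/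
noncomputable def moment (p ρ : I) (i j : ℕ) : ℝ :=
  ((p : ℝ) ^ 2 + ρ * (p * (1 - p))) * ((1 - p) ^ i * (1 - p) ^ j)
    + ((1 - ρ) * (p * (1 - p))) * ((1 - p) ^ i * (-p) ^ j)
    + ((1 - ρ) * (p * (1 - p))) * ((-p) ^ i * (1 - p) ^ j)
    + ((1 - (p : ℝ)) ^ 2 + ρ * (p * (1 - p))) * ((-p) ^ i * (-p) ^ j)

/-- The number of the sets `A`, `B` that contain `e`. -/
def mult {α : Type*} [DecidableEq α] (A B : Finset α) (e : α) : ℕ :=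
  (if e ∈ A then 1 else 0) + (if e ∈ B then 1 else 0)

lemma nonneg_mul (p : I) : 0 ≤ (p : ℝ) * (1 - p) := mul_nonneg p.2.1 (sub_nonneg.2 p.2.2)

instance isProbabilityMeasure_correlatedBernoulli (p ρ : I) :
    IsProbabilityMeasure (correlatedBernoulli p ρ) := by
  have hs := nonneg_mul p
  have h1 : 0 ≤ (ρ : ℝ) * (p * (1 - p)) := mul_nonneg ρ.2.1 hs
  have h2 : 0 ≤ (1 - ρ : ℝ) * (p * (1 - p)) := mul_nonneg (sub_nonneg.2 ρ.2.2) hs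
  constructor
  simp only [correlatedBernoulli, Measure.coe_add, Pi.add_apply, Measure.smul_apply, measure_univ,
    smul_eq_mul, mul_one]
  rw [← ENNReal.ofReal_add (by positivity) h2, ← ENNReal.ofReal_add (by positivity) h2,
    ← ENNReal.ofReal_add (by positivity) (by positivity), ← ENNReal.ofReal_one]
  congr 1
  ring

lemma integral_correlatedBernoulli (p ρ : I) (i j : ℕ) :
    ∫ b : Bool × Bool, ((if b.1 then (1 : ℝ) else 0) - p) ^ i
      * ((if b.2 then (1 : ℝ) else 0) - p) ^ j ∂correlatedBernoulli p ρ = moment p ρ i j := by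
  have hs := nonneg_mul p
  have h1 : 0 ≤ (ρ : ℝ) * (p * (1 - p)) := mul_nonneg ρ.2.1 hs
  have h2 : 0 ≤ (1 - ρ : ℝ) * (p * (1 - p)) := mul_nonneg (sub_nonneg.2 ρ.2.2) hs
  have h3 : 0 ≤ (p : ℝ) ^ 2 + ρ * (p * (1 - p)) := by positivity
  have h4 : 0 ≤ (1 - (p : ℝ)) ^ 2 + ρ * (p * (1 - p)) := by positivity
  have hi : ∀ (c : ℝ) (b : Bool × Bool), Integrable (fun b : Bool × Bool =>
      ((if b.1 then (1 : ℝ) else 0) - p) ^ i * ((if b.2 then (1 : ℝ) else 0) - p) ^ j)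
      (ENNReal.ofReal c • Measure.dirac b) := fun c b =>
    (Integrable.of_finite).smul_measure ENNReal.ofReal_ne_top
  rw [correlatedBernoulli, integral_add_measure
      (((hi _ _).add_measure (hi _ _)).add_measure (hi _ _)) (hi _ _),
    integral_add_measure ((hi _ _).add_measure (hi _ _)) (hi _ _),
    integral_add_measure (hi _ _) (hi _ _)]
  simp only [integral_smul_measure, integral_dirac, ENNReal.toReal_ofReal, h2, h3, h4, moment,
    smul_eq_mul]
  simp

lemma centered_graphPair_fst {n : ℕ} (p : I) (x : Sym2 (Fin n) → Bool × Bool)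
    {e : Sym2 (Fin n)} (he : ¬ e.IsDiag) :
    centered p (graphPair 1 x).1 e = (if (x e).1 then (1 : ℝ) else 0) - p := by
  simp [centered, graphPair, he]

lemma centered_graphPair_snd {n : ℕ} (p : I) (x : Sym2 (Fin n) → Bool × Bool)
    {e : Sym2 (Fin n)} (he : ¬ e.IsDiag) :
    centered p (graphPair 1 x).2 e = (if (x e).2 then (1 : ℝ) else 0) - p := by
  have h := centered_map p 1 (SimpleGraph.fromEdgeSet {e | (x e).2 = true}) e
  have h' : e.map (1 : Equiv.Perm (Fin n)) = e := Sym2.map_id' ▸ rfl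
  rw [h'] at h
  rw [graphPair, h]
  simp [centered, he]

/-- Independence across vertex pairs; the exponents at `e` count the copies through `e` in each of
the two graphs. -/
lemma integral_pi_character {n : ℕ} (p ρ : I) {A₁ B₁ A₂ B₂ : Finset (Sym2 (Fin n))}
    (hA₁ : ∀ e ∈ A₁, ¬ e.IsDiag) (hB₁ : ∀ e ∈ B₁, ¬ e.IsDiag)
    (hA₂ : ∀ e ∈ A₂, ¬ e.IsDiag) (hB₂ : ∀ e ∈ B₂, ¬ e.IsDiag) :
    ∫ x, character p A₁ (graphPair 1 x).1 * character p B₁ (graphPair 1 x).1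
        * (character p A₂ (graphPair 1 x).2 * character p B₂ (graphPair 1 x).2)
        ∂(Measure.pi fun _ : Sym2 (Fin n) => correlatedBernoulli p ρ)
      = ∏ e, moment p ρ (mult A₁ B₁ e) (mult A₂ B₂ e) := by
  have key : ∀ x : Sym2 (Fin n) → Bool × Bool,
      character p A₁ (graphPair 1 x).1 * character p B₁ (graphPair 1 x).1
        * (character p A₂ (graphPair 1 x).2 * character p B₂ (graphPair 1 x).2)
      = ∏ e, (((if (x e).1 then (1 : ℝ) else 0) - p) ^ (mult A₁ B₁ e)
          * ((if (x e).2 then (1 : ℝ) else 0) - p) ^ (mult A₂ B₂ e)) := by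
    intro x
    simp only [character_eq_prod_univ, ← Finset.prod_mul_distrib, ← pow_add]
    refine Finset.prod_congr rfl fun e _ => ?_
    by_cases hd : e.IsDiag
    · have h1 : e ∉ A₁ := fun h => hA₁ e h hd
      have h2 : e ∉ B₁ := fun h => hB₁ e h hd
      have h3 : e ∉ A₂ := fun h => hA₂ e h hd
      have h4 : e ∉ B₂ := fun h => hB₂ e h hd
      simp [h1, h2, h3, h4, mult]
    · rw [centered_graphPair_fst p x hd, centered_graphPair_snd p x hd]; rfl
  simp only [key]
  rw [integral_fintype_prod_eq_prod (𝕜 := ℝ)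
    (fun e (b : Bool × Bool) => ((if b.1 then (1 : ℝ) else 0) - p) ^ (mult A₁ B₁ e)
          * ((if b.2 then (1 : ℝ) else 0) - p) ^ (mult A₂ B₂ e))]
  exact Finset.prod_congr rfl fun e _ => integral_correlatedBernoulli p ρ _ _

lemma moment_zero_zero (p ρ : I) : moment p ρ 0 0 = 1 := by simp only [moment]; ring

lemma moment_one_zero (p ρ : I) : moment p ρ 1 0 = 0 := by simp only [moment]; ring

lemma moment_zero_one (p ρ : I) : moment p ρ 0 1 = 0 := by simp only [moment]; ring

lemma moment_one_one (p ρ : I) : moment p ρ 1 1 = ρ * (p * (1 - p)) := by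
  simp only [moment]; ring

lemma moment_two_zero (p ρ : I) : moment p ρ 2 0 = p * (1 - p) := by simp only [moment]; ring

lemma moment_zero_two (p ρ : I) : moment p ρ 0 2 = p * (1 - p) := by simp only [moment]; ring

lemma moment_two_one (p ρ : I) : moment p ρ 2 1 = (1 - 2 * p) * ρ * (p * (1 - p)) := by
  simp only [moment]; ring

lemma moment_one_two (p ρ : I) : moment p ρ 1 2 = (1 - 2 * p) * ρ * (p * (1 - p)) := by
  simp only [moment]; ring

lemma moment_two_two (p ρ : I) : moment p ρ 2 2
    = (p * (1 - p)) * (p * (1 - p) + (1 - 4 * (p * (1 - p))) * ρ) := by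
  simp only [moment]; ring

/-- Mixed moments of total order at least two are at most the variance. -/
lemma abs_moment_le (p ρ : I) {i j : ℕ} (hi : i ≤ 2) (hj : j ≤ 2) (hij : 2 ≤ i + j) :
    |moment p ρ i j| ≤ p * (1 - p) := by
  have hs := nonneg_mul p
  have hp0 : (0 : ℝ) ≤ p := p.2.1
  have hp1 : (p : ℝ) ≤ 1 := p.2.2
  have hρ0 : (0 : ℝ) ≤ ρ := ρ.2.1
  have hρ1 : (ρ : ℝ) ≤ 1 := ρ.2.2
  have h3 : |(1 - 2 * p : ℝ) * ρ * (p * (1 - p))| ≤ p * (1 - p) := by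
    rw [abs_mul, abs_mul, abs_of_nonneg hs, abs_of_nonneg hρ0]
    have : |(1 - 2 * p : ℝ)| ≤ 1 := abs_le.2 ⟨by linarith, by linarith⟩
    exact mul_le_of_le_one_left hs (mul_le_one₀ this hρ0 hρ1)
  have h4 : |(p * (1 - p) : ℝ) * (p * (1 - p) + (1 - 4 * (p * (1 - p))) * ρ)| ≤ p * (1 - p) := by
    -- With `s ≤ 1/4` the coefficient `1 - 4s` is nonnegative, so the second factor lies between `0`
    -- and `1 - 3s`.
    have hq : (p * (1 - p) : ℝ) ≤ 1 / 4 := by nlinarith [sq_nonneg ((p : ℝ) - 1 / 2)]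
    rw [abs_mul, abs_of_nonneg hs]
    refine mul_le_of_le_one_right hs (abs_le.2 ⟨?_, ?_⟩)
    · nlinarith
    · nlinarith
  have h1 : |(ρ : ℝ) * (p * (1 - p))| ≤ p * (1 - p) := by
    rw [abs_of_nonneg (by positivity)]
    exact mul_le_of_le_one_left hs hρ1
  interval_cases i <;> interval_cases j <;>
    first
    | omega
    | simpa only [moment_one_one] using h1
    | simpa only [moment_two_zero] using (abs_of_nonneg hs).le
    | simpa only [moment_zero_two] using (abs_of_nonneg hs).le
    | simpa only [moment_two_one] using h3
    | simpa only [moment_one_two] using h3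
    | simpa only [moment_two_two] using h4

/-! ### Overlapping copies of motifs -/

lemma mult_le_two {α : Type*} [DecidableEq α] (A B : Finset α) (e : α) : mult A B e ≤ 2 := by
  unfold mult; split_ifs <;> omega

/-- If every covered point is covered at least twice by `A`, `B`, `C`, `D`, the excess of the
multiplicities is counted by two triple intersections. -/
lemma card_add_card_of_mult_ne_one {α : Type*} [DecidableEq α] {A B C D : Finset α}
    (h : ∀ x, mult A B x + mult C D x ≠ 1) :
    A.card + B.card + C.card + D.card
      = 2 * (A ∪ B ∪ (C ∪ D)).card + (A ∩ B ∩ (C ∪ D)).card + (C ∩ D ∩ (A ∪ B)).card := by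
  have hc : ∀ S : Finset α, S ⊆ A ∪ B ∪ (C ∪ D) →
      S.card = ∑ x ∈ A ∪ B ∪ (C ∪ D), if x ∈ S then 1 else 0 := by
    intro S hS
    rw [← Finset.sum_filter, Finset.sum_const, smul_eq_mul, mul_one,
      Finset.filter_mem_eq_inter, Finset.inter_eq_right.2 hS]
  rw [hc A (by grind), hc B (by grind), hc C (by grind), hc D (by grind),
    hc (A ∩ B ∩ (C ∪ D)) (by grind), hc (C ∩ D ∩ (A ∪ B)) (by grind), Finset.card_eq_sum_ones,
    Finset.mul_sum, ← Finset.sum_add_distrib, ← Finset.sum_add_distrib, ← Finset.sum_add_distrib,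
    ← Finset.sum_add_distrib, ← Finset.sum_add_distrib]
  refine Finset.sum_congr rfl fun x hx => ?_
  have hx' := h x
  simp only [mult] at hx'
  -- A point of multiplicity 2, 3 or 4 lies in 0, 1 or 2 of the two triple intersections.
  by_cases h1 : x ∈ A <;> by_cases h2 : x ∈ B <;> by_cases h3 : x ∈ C <;> by_cases h4 : x ∈ D <;>
    simp_all

/-- The vertex set of the copy `φ(M)` of a motif. -/
def vertImage {n : ℕ} (M : Motif) (φ : Fin M.v ↪ Fin n) : Finset (Fin n) :=
  Finset.univ.map φ

lemma card_vertImage {n : ℕ} (M : Motif) (φ : Fin M.v ↪ Fin n) :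
    (vertImage M φ).card = M.v := by simp [vertImage]

lemma mem_vertImage {n : ℕ} {M : Motif} {φ : Fin M.v ↪ Fin n} {w : Fin n} :
    w ∈ vertImage M φ ↔ ∃ a, φ a = w := by simp [vertImage]

lemma mem_vertImage_of_mem_edgeImage {n : ℕ} {M : Motif} {φ : Fin M.v ↪ Fin n}
    {e : Sym2 (Fin n)} (he : e ∈ edgeImage M φ) {w : Fin n} (hw : w ∈ e) : w ∈ vertImage M φ := by
  obtain ⟨a, b, -, rfl⟩ := mem_edgeImage.1 he
  rw [mem_vertImage]
  rcases Sym2.mem_iff.1 hw with rfl | rfl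
  exacts [⟨a, rfl⟩, ⟨b, rfl⟩]

lemma edgeImage_nonempty {n : ℕ} {M : Motif} (he : 1 ≤ M.e) (φ : Fin M.v ↪ Fin n) :
    (edgeImage M φ).Nonempty := by
  rw [← Finset.card_pos, card_edgeImage]; exact he

lemma exists_adj_of_one_le_e {M : Motif} (he : 1 ≤ M.e) : ∃ a b, M.graph.Adj a b := by
  have h : M.graph.edgeSet.Nonempty := Set.nonempty_of_ncard_ne_zero (by unfold Motif.e at he; omega)
  obtain ⟨e, h⟩ := h
  induction e with
  | _ a b => exact ⟨a, b, h⟩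

lemma exists_adj_of_connected {M : Motif} (hM : M.graph.Connected) (he : 1 ≤ M.e) (a : Fin M.v) :
    ∃ b, M.graph.Adj a b := by
  obtain ⟨c, d, hcd⟩ := exists_adj_of_one_le_e he
  obtain ⟨w⟩ := hM.preconnected a c
  cases w with
  | nil => exact ⟨d, hcd⟩
  | cons h _ => exact ⟨_, h⟩

lemma exists_mem_edgeImage_of_mem_vertImage {n : ℕ} {M : Motif} (hM : M.graph.Connected)
    (he : 1 ≤ M.e) {φ : Fin M.v ↪ Fin n} {w : Fin n} (hw : w ∈ vertImage M φ) :
    ∃ e ∈ edgeImage M φ, w ∈ e := by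
  obtain ⟨a, rfl⟩ := mem_vertImage.1 hw
  obtain ⟨b, hb⟩ := exists_adj_of_connected hM he a
  exact ⟨s(φ a, φ b), mk_mem_edgeImage.2 hb, Sym2.mem_mk_left _ _⟩

/-- A connected copy that shares an edge with `J` and has no edge outside of `J` touching the
vertices of `J` is contained in `J`. -/
lemma edgeImage_subset_of_connected {n : ℕ} {M : Motif} (hM : M.graph.Connected)
    {φ : Fin M.v ↪ Fin n} {J : Finset (Sym2 (Fin n))} {V : Finset (Fin n)}
    (hJ : ∀ e ∈ J, ∀ w ∈ e, w ∈ V)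
    (hout : ∀ e ∈ edgeImage M φ, e ∉ J → ∀ w ∈ e, w ∉ V)
    {e₀ : Sym2 (Fin n)} (h₀ : e₀ ∈ edgeImage M φ) (h₀' : e₀ ∈ J) : edgeImage M φ ⊆ J := by
  have hadj : ∀ a b, M.graph.Adj a b → φ a ∈ V → s(φ a, φ b) ∈ J := by
    intro a b hab ha
    by_contra hcon
    exact hout _ (mk_mem_edgeImage.2 hab) hcon _ (Sym2.mem_mk_left _ _) ha
  obtain ⟨c, d, -, rfl⟩ := mem_edgeImage.1 h₀
  have hc : φ c ∈ V := hJ _ h₀' _ (Sym2.mem_mk_left _ _)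
  -- Membership in `V` propagates along walks: an edge at a vertex of `V` lies in `J`, so its other
  -- end is in `V`.
  have hall : ∀ a b, M.graph.Walk a b → φ a ∈ V → φ b ∈ V := by
    intro a b w
    induction w with
    | nil => exact id
    | cons h _ ih => exact fun ha => ih (hJ _ (hadj _ _ h ha) _ (Sym2.mem_mk_right _ _))
  intro e he
  obtain ⟨a, b, hab, rfl⟩ := mem_edgeImage.1 he
  obtain ⟨w⟩ := hM.preconnected c a
  exact hadj a b hab (hall c a w hc)

/-- Connected motifs with an edge have no isolated vertex, so equal edge images have equal vertex
images and `ψ⁻¹ ∘ φ` is an isomorphism. -/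
lemma nonempty_iso_of_edgeImage_eq {n : ℕ} {M N : Motif} (hM : M.graph.Connected)
    (hN : N.graph.Connected) (heM : 1 ≤ M.e) (heN : 1 ≤ N.e) {φ : Fin M.v ↪ Fin n}
    {ψ : Fin N.v ↪ Fin n} (h : edgeImage M φ = edgeImage N ψ) :
    Nonempty (M.graph ≃g N.graph) := by
  have hsub : ∀ a, ∃ b, ψ b = φ a := by
    intro a
    obtain ⟨e, he, hw⟩ := exists_mem_edgeImage_of_mem_vertImage hM heM (φ := φ)
      (mem_vertImage.2 ⟨a, rfl⟩)
    exact mem_vertImage.1 (mem_vertImage_of_mem_edgeImage (h ▸ he) hw)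
  have hsub' : ∀ b, ∃ a, φ a = ψ b := by
    intro b
    obtain ⟨e, he, hw⟩ := exists_mem_edgeImage_of_mem_vertImage hN heN (φ := ψ)
      (mem_vertImage.2 ⟨b, rfl⟩)
    exact mem_vertImage.1 (mem_vertImage_of_mem_edgeImage (h.symm ▸ he) hw)
  choose f hf using hsub
  choose g hg using hsub'
  refine ⟨⟨⟨f, g, fun a => φ.injective (by rw [hg, hf]), fun b => ψ.injective (by rw [hf, hg])⟩, ?_⟩⟩
  intro a b
  change N.graph.Adj (f a) (f b) ↔ M.graph.Adj a b
  rw [← mk_mem_edgeImage (φ := ψ), ← mk_mem_edgeImage (φ := φ), hf, hf, h]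

/-- Four nonempty sets, each contained in another one, with empty triple intersections, form two
pairs of equal sets. -/
lemma pairing_of_subset {α : Type*} {A B C D : Finset α} (nA : A.Nonempty) (nB : B.Nonempty)
    (nC : C.Nonempty) (nD : D.Nonempty) (hA : A ⊆ B ∨ A ⊆ C ∨ A ⊆ D) (hB : B ⊆ A ∨ B ⊆ C ∨ B ⊆ D)
    (hC : C ⊆ A ∨ C ⊆ B ∨ C ⊆ D) (hD : D ⊆ A ∨ D ⊆ B ∨ D ⊆ C)
    (hABC : ∀ e, e ∈ A → e ∈ B → e ∉ C) (hABD : ∀ e, e ∈ A → e ∈ B → e ∉ D)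
    (hACD : ∀ e, e ∈ A → e ∈ C → e ∉ D) (hBCD : ∀ e, e ∈ B → e ∈ C → e ∉ D) :
    (A = B ∧ C = D) ∨ (A = C ∧ B = D) ∨ (A = D ∧ B = C) := by
  obtain ⟨a, ha⟩ := nA
  obtain ⟨b, hb⟩ := nB
  obtain ⟨c, hc⟩ := nC
  obtain ⟨d, hd⟩ := nD
  -- A chain `X ⊆ Y ⊆ Z` of three different members of the list puts a point of `X` in three sets.
  -- So if `X ⊆ Y`, the set containing `Y` can only be `X`.
  rcases hA with hA | hA | hA <;> rcases hB with hB | hB | hB <;>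
    first
    | (exfalso; grind)
    | (rcases hC with hC | hC | hC <;> rcases hD with hD | hD | hD <;>
        first
        | (exfalso; grind)
        | exact Or.inl ⟨hA.antisymm hB, hC.antisymm hD⟩
        | exact Or.inr (Or.inl ⟨hA.antisymm hC, hB.antisymm hD⟩)
        | exact Or.inr (Or.inr ⟨hA.antisymm hD, hB.antisymm hC⟩))

/-- If no vertex lies in three of four copies and every edge of the first one lies in another
copy, then the first one is contained in another one. -/
lemma edgeImage_subset_or {n : ℕ} {M J L R : Motif} (hM : M.graph.Connected) (he : 1 ≤ M.e)
    {φ : Fin M.v ↪ Fin n} {φJ : Fin J.v ↪ Fin n} {φL : Fin L.v ↪ Fin n} {φR : Fin R.v ↪ Fin n}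
    (hcov : ∀ e ∈ edgeImage M φ, e ∈ edgeImage J φJ ∨ e ∈ edgeImage L φL ∨ e ∈ edgeImage R φR)
    (hJL : ∀ w ∈ vertImage M φ, w ∈ vertImage J φJ → w ∉ vertImage L φL)
    (hJR : ∀ w ∈ vertImage M φ, w ∈ vertImage J φJ → w ∉ vertImage R φR)
    (hLR : ∀ w ∈ vertImage M φ, w ∈ vertImage L φL → w ∉ vertImage R φR) :
    edgeImage M φ ⊆ edgeImage J φJ ∨ edgeImage M φ ⊆ edgeImage L φL
      ∨ edgeImage M φ ⊆ edgeImage R φR := by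
  obtain ⟨e₀, h₀⟩ := edgeImage_nonempty he φ
  have hv : ∀ {K : Motif} {φK : Fin K.v ↪ Fin n}, ∀ e ∈ edgeImage K φK, ∀ w ∈ e,
      w ∈ vertImage K φK := fun e he w hw => mem_vertImage_of_mem_edgeImage he hw
  -- One edge selects the containing copy. An edge of `φ(M)` outside that copy lies in yet another
  -- one, so an endpoint in the selected copy would lie in three.
  rcases hcov e₀ h₀ with h | h | h
  · refine Or.inl (edgeImage_subset_of_connected hM hv (fun e he hn w hw hwV => ?_) h₀ h)
    rcases hcov e he with h | h | h
    exacts [hn h, hJL w (hv e he w hw) hwV (hv e h w hw), hJR w (hv e he w hw) hwV (hv e h w hw)]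
  · refine Or.inr (Or.inl
      (edgeImage_subset_of_connected hM hv (fun e he hn w hw hwV => ?_) h₀ h))
    rcases hcov e he with h | h | h
    exacts [hJL w (hv e he w hw) (hv e h w hw) hwV, hn h, hLR w (hv e he w hw) hwV (hv e h w hw)]
  · refine Or.inr (Or.inr
      (edgeImage_subset_of_connected hM hv (fun e he hn w hw hwV => ?_) h₀ h))
    rcases hcov e he with h | h | h
    exacts [hJR w (hv e he w hw) (hv e h w hw) hwV, hLR w (hv e he w hw) (hv e h w hw) hwV, hn h]

section Quadruple

variable {n : ℕ} {M N : Motif}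

/-- Every edge covered by two copies of `M` and two copies of `N` is covered at least twice. -/
def IsCovering (φ₁ φ₂ : Fin M.v ↪ Fin n) (ψ₁ ψ₂ : Fin N.v ↪ Fin n) : Prop :=
  ∀ e, mult (edgeImage M φ₁) (edgeImage N ψ₁) e + mult (edgeImage M φ₂) (edgeImage N ψ₂) e ≠ 1

/-- The vertices shared by `φ₁(M)`, `ψ₁(N)` and one of the other two copies. -/
def tripleVerts (φ₁ φ₂ : Fin M.v ↪ Fin n) (ψ₁ ψ₂ : Fin N.v ↪ Fin n) : Finset (Fin n) :=
  vertImage M φ₁ ∩ vertImage N ψ₁ ∩ (vertImage M φ₂ ∪ vertImage N ψ₂)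

/-- The edges shared by `φ₁(M)`, `ψ₁(N)` and one of the other two copies. -/
noncomputable def tripleEdges (φ₁ φ₂ : Fin M.v ↪ Fin n) (ψ₁ ψ₂ : Fin N.v ↪ Fin n) :
    Finset (Sym2 (Fin n)) :=
  edgeImage M φ₁ ∩ edgeImage N ψ₁ ∩ (edgeImage M φ₂ ∪ edgeImage N ψ₂)

/-- A vertex shared by three of the four copies exists. -/
def HasTriple (φ₁ φ₂ : Fin M.v ↪ Fin n) (ψ₁ ψ₂ : Fin N.v ↪ Fin n) : Prop :=
  (tripleVerts φ₁ φ₂ ψ₁ ψ₂).Nonempty ∨ (tripleVerts φ₂ φ₁ ψ₂ ψ₁).Nonempty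

/-- The vertex set of the union of the four copies. -/
def unionVerts (φ₁ φ₂ : Fin M.v ↪ Fin n) (ψ₁ ψ₂ : Fin N.v ↪ Fin n) : Finset (Fin n) :=
  vertImage M φ₁ ∪ vertImage N ψ₁ ∪ (vertImage M φ₂ ∪ vertImage N ψ₂)

/-- The edge set of the union of the four copies. -/
noncomputable def unionEdges (φ₁ φ₂ : Fin M.v ↪ Fin n) (ψ₁ ψ₂ : Fin N.v ↪ Fin n) :
    Finset (Sym2 (Fin n)) :=
  edgeImage M φ₁ ∪ edgeImage N ψ₁ ∪ (edgeImage M φ₂ ∪ edgeImage N ψ₂)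

variable {φ₁ φ₂ : Fin M.v ↪ Fin n} {ψ₁ ψ₂ : Fin N.v ↪ Fin n}

/-- Four copies that cover all their edges at least twice and have no vertex in common to three
of them form two disjoint pairs of identical copies. -/
lemma pairing_of_isCovering (hM : M.graph.Connected) (hN : N.graph.Connected) (heM : 1 ≤ M.e)
    (heN : 1 ≤ N.e) (hcov : IsCovering φ₁ φ₂ ψ₁ ψ₂) (htr : ¬ HasTriple φ₁ φ₂ ψ₁ ψ₂) :
    (edgeImage M φ₁ = edgeImage N ψ₁ ∧ edgeImage M φ₂ = edgeImage N ψ₂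
        ∧ Disjoint (edgeImage M φ₁) (edgeImage M φ₂))
      ∨ (edgeImage M φ₁ = edgeImage M φ₂ ∧ edgeImage N ψ₁ = edgeImage N ψ₂
        ∧ Disjoint (edgeImage M φ₁) (edgeImage N ψ₁))
      ∨ (edgeImage M φ₁ = edgeImage N ψ₂ ∧ edgeImage N ψ₁ = edgeImage M φ₂
        ∧ Disjoint (edgeImage M φ₁) (edgeImage N ψ₁)) := by
  have hcov' : ∀ e, mult (edgeImage M φ₁) (edgeImage N ψ₁) e
      + mult (edgeImage M φ₂) (edgeImage N ψ₂) e ≠ 1 := hcov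
  simp only [mult] at hcov'
  simp only [HasTriple, tripleVerts, not_or, Finset.not_nonempty_iff_eq_empty,
    Finset.eq_empty_iff_forall_notMem, Finset.mem_inter, Finset.mem_union] at htr
  obtain ⟨hX, hY⟩ := htr
  have v1 : ∀ w, w ∈ vertImage M φ₁ → w ∈ vertImage N ψ₁ → w ∉ vertImage M φ₂ :=
    fun w h1 h2 h3 => hX w ⟨⟨h1, h2⟩, Or.inl h3⟩
  have v2 : ∀ w, w ∈ vertImage M φ₁ → w ∈ vertImage N ψ₁ → w ∉ vertImage N ψ₂ :=
    fun w h1 h2 h3 => hX w ⟨⟨h1, h2⟩, Or.inr h3⟩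
  have v3 : ∀ w, w ∈ vertImage M φ₁ → w ∈ vertImage M φ₂ → w ∉ vertImage N ψ₂ :=
    fun w h1 h2 h3 => hY w ⟨⟨h2, h3⟩, Or.inl h1⟩
  have v4 : ∀ w, w ∈ vertImage N ψ₁ → w ∈ vertImage M φ₂ → w ∉ vertImage N ψ₂ :=
    fun w h1 h2 h3 => hY w ⟨⟨h2, h3⟩, Or.inr h1⟩
  -- An edge common to three copies would have its endpoint `e.out.1` in all three.
  have hv : ∀ {K : Motif} {φK : Fin K.v ↪ Fin n} {e : Sym2 (Fin n)}, e ∈ edgeImage K φK →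
      e.out.1 ∈ vertImage K φK := fun he => mem_vertImage_of_mem_edgeImage he (Sym2.out_fst_mem _)
  have e1 : ∀ e, e ∈ edgeImage M φ₁ → e ∈ edgeImage N ψ₁ → e ∉ edgeImage M φ₂ :=
    fun e h1 h2 h3 => v1 _ (hv h1) (hv h2) (hv h3)
  have e2 : ∀ e, e ∈ edgeImage M φ₁ → e ∈ edgeImage N ψ₁ → e ∉ edgeImage N ψ₂ :=
    fun e h1 h2 h3 => v2 _ (hv h1) (hv h2) (hv h3)
  have e3 : ∀ e, e ∈ edgeImage M φ₁ → e ∈ edgeImage M φ₂ → e ∉ edgeImage N ψ₂ :=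
    fun e h1 h2 h3 => v3 _ (hv h1) (hv h2) (hv h3)
  have e4 : ∀ e, e ∈ edgeImage N ψ₁ → e ∈ edgeImage M φ₂ → e ∉ edgeImage N ψ₂ :=
    fun e h1 h2 h3 => v4 _ (hv h1) (hv h2) (hv h3)
  have s1 := edgeImage_subset_or hM heM (φ := φ₁) (φJ := ψ₁) (φL := φ₂) (φR := ψ₂)
    (fun e he => by have := hcov' e; grind) (by grind) (by grind) (by grind)
  have s2 := edgeImage_subset_or hN heN (φ := ψ₁) (φJ := φ₁) (φL := φ₂) (φR := ψ₂)
    (fun e he => by have := hcov' e; grind) (by grind) (by grind) (by grind)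
  have s3 := edgeImage_subset_or hM heM (φ := φ₂) (φJ := φ₁) (φL := ψ₁) (φR := ψ₂)
    (fun e he => by have := hcov' e; grind) (by grind) (by grind) (by grind)
  have s4 := edgeImage_subset_or hN heN (φ := ψ₂) (φJ := φ₁) (φL := ψ₁) (φR := φ₂)
    (fun e he => by have := hcov' e; grind) (by grind) (by grind) (by grind)
  rcases pairing_of_subset (edgeImage_nonempty heM φ₁) (edgeImage_nonempty heN ψ₁)
    (edgeImage_nonempty heM φ₂) (edgeImage_nonempty heN ψ₂) s1 s2 s3 s4 e1 e2 e3 e4 with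
    ⟨h1, h2⟩ | ⟨h1, h2⟩ | ⟨h1, h2⟩
  · exact Or.inl ⟨h1, h2, Finset.disjoint_left.2 fun e h3 => e1 e h3 (h1 ▸ h3)⟩
  · exact Or.inr (Or.inl ⟨h1, h2, Finset.disjoint_left.2 fun e h3 h4 => e1 e h3 h4 (h1 ▸ h3)⟩)
  · exact Or.inr (Or.inr ⟨h1, h2, Finset.disjoint_left.2 fun e h3 h4 => e2 e h3 h4 (h1 ▸ h3)⟩)

/-- A vertex of a copy is an endpoint of one of its edges; the second copy covering that edge
contains the vertex too. -/
lemma vert_mult_ne_one (hM : M.graph.Connected) (hN : N.graph.Connected) (heM : 1 ≤ M.e)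
    (heN : 1 ≤ N.e) (hcov : IsCovering φ₁ φ₂ ψ₁ ψ₂) (w : Fin n) :
    mult (vertImage M φ₁) (vertImage N ψ₁) w + mult (vertImage M φ₂) (vertImage N ψ₂) w ≠ 1 := by
  have hM' := fun φ : Fin M.v ↪ Fin n =>
    exists_mem_edgeImage_of_mem_vertImage hM heM (φ := φ) (w := w)
  have hN' := fun φ : Fin N.v ↪ Fin n =>
    exists_mem_edgeImage_of_mem_vertImage hN heN (φ := φ) (w := w)
  have hvM := fun (φ : Fin M.v ↪ Fin n) (e : Sym2 (Fin n)) (he : e ∈ edgeImage M φ) (hw : w ∈ e) =>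
    mem_vertImage_of_mem_edgeImage he hw
  have hvN := fun (φ : Fin N.v ↪ Fin n) (e : Sym2 (Fin n)) (he : e ∈ edgeImage N φ) (hw : w ∈ e) =>
    mem_vertImage_of_mem_edgeImage he hw
  intro hone
  have hex : ∃ e, w ∈ e ∧ (e ∈ edgeImage M φ₁ ∨ e ∈ edgeImage N ψ₁ ∨ e ∈ edgeImage M φ₂
      ∨ e ∈ edgeImage N ψ₂) := by
    simp only [mult] at hone
    by_cases h1 : w ∈ vertImage M φ₁
    · obtain ⟨e, he, hw⟩ := hM' _ h1; exact ⟨e, hw, by tauto⟩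
    by_cases h2 : w ∈ vertImage N ψ₁
    · obtain ⟨e, he, hw⟩ := hN' _ h2; exact ⟨e, hw, by tauto⟩
    by_cases h3 : w ∈ vertImage M φ₂
    · obtain ⟨e, he, hw⟩ := hM' _ h3; exact ⟨e, hw, by tauto⟩
    by_cases h4 : w ∈ vertImage N ψ₂
    · obtain ⟨e, he, hw⟩ := hN' _ h4; exact ⟨e, hw, by tauto⟩
    simp [h1, h2, h3, h4] at hone
  obtain ⟨e, hw, he⟩ := hex
  have hc := hcov e
  have k1 := fun h => hvM φ₁ e h hw
  have k2 := fun h => hvM φ₂ e h hw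
  have k3 := fun h => hvN ψ₁ e h hw
  have k4 := fun h => hvN ψ₂ e h hw
  simp only [mult] at hone hc
  grind

end Quadruple

/-! ### Density of triple overlaps -/

/-- The density condition on the subgraphs of a motif, for subgraphs of a copy. -/
lemma rpow_le_of_subset_image {n : ℕ} {M : Motif} {p : I} {ε : ℝ}
    (h : ∀ M' : M.graph.Subgraph, M'.verts.Nonempty →
      (n : ℝ) ^ ε ≤ (n : ℝ) ^ M'.verts.ncard * (p : ℝ) ^ M'.edgeSet.ncard)
    {φ : Fin M.v ↪ Fin n} {V : Finset (Fin n)} {E : Finset (Sym2 (Fin n))}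
    (hV : V ⊆ vertImage M φ) (hE : E ⊆ edgeImage M φ) (hEV : ∀ e ∈ E, ∀ w ∈ e, w ∈ V)
    (hne : V.Nonempty) : (n : ℝ) ^ ε ≤ (n : ℝ) ^ V.card * (p : ℝ) ^ E.card := by
  classical
  let M' : M.graph.Subgraph :=
    { verts := {a | φ a ∈ V}
      Adj := fun a b => s(φ a, φ b) ∈ E
      adj_sub := fun h => mk_mem_edgeImage.1 (hE h)
      edge_vert := fun h => hEV _ h _ (Sym2.mem_mk_left _ _)
      symm := ⟨fun a b h => by rw [Sym2.eq_swap]; exact h⟩ }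
  have hv : M'.verts.ncard = V.card := by
    rw [← Set.ncard_image_of_injective _ φ.injective, ← Set.ncard_coe_finset]
    congr 1
    ext w
    constructor
    · rintro ⟨a, ha, rfl⟩; exact ha
    · intro hw
      obtain ⟨a, rfl⟩ := mem_vertImage.1 (hV hw)
      exact ⟨a, hw, rfl⟩
  have he : M'.edgeSet.ncard = E.card := by
    rw [← Set.ncard_image_of_injective _ φ.sym2Map.injective, ← Set.ncard_coe_finset]
    congr 1
    ext e
    constructor
    · rintro ⟨e', he', rfl⟩
      induction e' with
      | _ a b => exact he'
    · intro hw
      obtain ⟨a, b, -, rfl⟩ := mem_edgeImage.1 (hE hw)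
      exact ⟨s(a, b), hw, rfl⟩
  rw [← hv, ← he]
  refine h M' ?_
  obtain ⟨w, hw⟩ := hne
  obtain ⟨a, rfl⟩ := mem_vertImage.1 (hV hw)
  exact ⟨a, hw⟩

section Quadruple

variable {n : ℕ} {M N : Motif} {φ₁ φ₂ : Fin M.v ↪ Fin n} {ψ₁ ψ₂ : Fin N.v ↪ Fin n}

/-- The density of the part shared by three copies, in terms of the variance `p (1 - p)`. -/
lemma le_density_triple {p : I} {ε δ : ℝ} {K : ℕ} (hδ : 0 < δ) (hp' : (p : ℝ) ≤ 1 - δ)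
    (hK : M.e ≤ K)
    (h : ∀ M' : M.graph.Subgraph, M'.verts.Nonempty →
      (n : ℝ) ^ ε ≤ (n : ℝ) ^ M'.verts.ncard * (p : ℝ) ^ M'.edgeSet.ncard)
    (hne : (tripleVerts φ₁ φ₂ ψ₁ ψ₂).Nonempty) :
    (n : ℝ) ^ ε * δ ^ K ≤ (n : ℝ) ^ (tripleVerts φ₁ φ₂ ψ₁ ψ₂).card
      * ((p : ℝ) * (1 - p)) ^ (tripleEdges φ₁ φ₂ ψ₁ ψ₂).card := by
  have hp0 : (0 : ℝ) ≤ p := p.2.1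
  have hδ1 : δ ≤ 1 := by linarith
  have hE : tripleEdges φ₁ φ₂ ψ₁ ψ₂ ⊆ edgeImage M φ₁ := fun e he => by
    simp only [tripleEdges, Finset.mem_inter] at he; exact he.1.1
  have hEK : (tripleEdges φ₁ φ₂ ψ₁ ψ₂).card ≤ K :=
    (Finset.card_le_card hE).trans ((card_edgeImage M φ₁).le.trans hK)
  have h1 := rpow_le_of_subset_image h (φ := φ₁) (V := tripleVerts φ₁ φ₂ ψ₁ ψ₂)
    (E := tripleEdges φ₁ φ₂ ψ₁ ψ₂)
    (fun w hw => by simp only [tripleVerts, Finset.mem_inter] at hw; exact hw.1.1) hE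
    (fun e he w hw => by
      simp only [tripleEdges, tripleVerts, Finset.mem_inter, Finset.mem_union] at he ⊢
      exact ⟨⟨mem_vertImage_of_mem_edgeImage he.1.1 hw, mem_vertImage_of_mem_edgeImage he.1.2 hw⟩,
        he.2.imp (fun h => mem_vertImage_of_mem_edgeImage h hw)
          (fun h => mem_vertImage_of_mem_edgeImage h hw)⟩) hne
  -- Admissibility speaks of `p`, the moments of `p(1-p) ≥ pδ`: the change costs one factor `δ` for
  -- each of at most `K` edges.
  calc (n : ℝ) ^ ε * δ ^ K
      ≤ ((n : ℝ) ^ (tripleVerts φ₁ φ₂ ψ₁ ψ₂).card * (p : ℝ) ^ (tripleEdges φ₁ φ₂ ψ₁ ψ₂).card)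
        * δ ^ (tripleEdges φ₁ φ₂ ψ₁ ψ₂).card :=
        mul_le_mul h1 (pow_le_pow_of_le_one hδ.le hδ1 hEK) (by positivity) (by positivity)
    _ = (n : ℝ) ^ (tripleVerts φ₁ φ₂ ψ₁ ψ₂).card
        * ((p : ℝ) * δ) ^ (tripleEdges φ₁ φ₂ ψ₁ ψ₂).card := by rw [mul_pow]; ring
    _ ≤ _ := by
        have : δ ≤ 1 - (p : ℝ) := by linarith
        gcongr

lemma tripleEdges_eq_empty (h : ¬ (tripleVerts φ₁ φ₂ ψ₁ ψ₂).Nonempty) :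
    tripleEdges φ₁ φ₂ ψ₁ ψ₂ = ∅ := by
  rw [Finset.not_nonempty_iff_eq_empty] at h
  by_contra hne
  obtain ⟨e, he⟩ := Finset.nonempty_iff_ne_empty.2 hne
  simp only [tripleEdges, Finset.mem_inter, Finset.mem_union] at he
  have hw := Sym2.out_fst_mem e
  have : e.out.1 ∈ tripleVerts φ₁ φ₂ ψ₁ ψ₂ := by
    simp only [tripleVerts, Finset.mem_inter, Finset.mem_union]
    exact ⟨⟨mem_vertImage_of_mem_edgeImage he.1.1 hw, mem_vertImage_of_mem_edgeImage he.1.2 hw⟩,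
        he.2.imp (fun h => mem_vertImage_of_mem_edgeImage h hw)
          (fun h => mem_vertImage_of_mem_edgeImage h hw)⟩
  simp [h] at this

/-- Handles the triple intersection that may be empty: both exponents then vanish, and `δ ^ K ≤ 1`.
-/
lemma pow_density_triple_le {p : I} {ε δ : ℝ} {K : ℕ} (hδ : 0 < δ) (hp' : (p : ℝ) ≤ 1 - δ)
    (hn : 1 ≤ n) (hε : 0 ≤ ε) (hK : M.e ≤ K)
    (h : ∀ M' : M.graph.Subgraph, M'.verts.Nonempty →
      (n : ℝ) ^ ε ≤ (n : ℝ) ^ M'.verts.ncard * (p : ℝ) ^ M'.edgeSet.ncard) :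
    δ ^ K ≤ (n : ℝ) ^ (tripleVerts φ₁ φ₂ ψ₁ ψ₂).card
      * ((p : ℝ) * (1 - p)) ^ (tripleEdges φ₁ φ₂ ψ₁ ψ₂).card := by
  have hp0 : (0 : ℝ) ≤ p := p.2.1
  by_cases hne : (tripleVerts φ₁ φ₂ ψ₁ ψ₂).Nonempty
  · refine le_trans ?_ (le_density_triple hδ hp' hK h hne)
    exact le_mul_of_one_le_left (by positivity)
      (Real.one_le_rpow (by exact_mod_cast hn) hε)
  · rw [tripleEdges_eq_empty hne, Finset.not_nonempty_iff_eq_empty.1 hne]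
    simpa using pow_le_one₀ hδ.le (by linarith)

/-- The weight of a quadruple of copies with a vertex common to three of them. -/
lemma weight_le_of_hasTriple {p : I} {ε δ : ℝ} {K : ℕ} (hδ : 0 < δ) (hp' : (p : ℝ) ≤ 1 - δ)
    (hn : 1 ≤ n) (hε : 0 ≤ ε) (hMK : M.e ≤ K)
    (hM : M.graph.Connected) (hN : N.graph.Connected) (heM : 1 ≤ M.e) (heN : 1 ≤ N.e)
    (h : ∀ M' : M.graph.Subgraph, M'.verts.Nonempty →
      (n : ℝ) ^ ε ≤ (n : ℝ) ^ M'.verts.ncard * (p : ℝ) ^ M'.edgeSet.ncard)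
    (hcov : IsCovering φ₁ φ₂ ψ₁ ψ₂) (htr : HasTriple φ₁ φ₂ ψ₁ ψ₂) :
    ((p : ℝ) * (1 - p)) ^ (unionEdges φ₁ φ₂ ψ₁ ψ₂).card
        * (n : ℝ) ^ (unionVerts φ₁ φ₂ ψ₁ ψ₂).card * ((n : ℝ) ^ (ε / 2) * δ ^ K)
      ≤ ((p : ℝ) * (1 - p)) ^ (M.e + N.e) * (n : ℝ) ^ (M.v + N.v) := by
  have hs := nonneg_mul p
  have hcov' : IsCovering φ₂ φ₁ ψ₂ ψ₁ := fun e => by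
    have := hcov e; rwa [add_comm] at this
  have cE := card_add_card_of_mult_ne_one hcov
  have cV := card_add_card_of_mult_ne_one (vert_mult_ne_one hM hN heM heN hcov)
  simp only [card_edgeImage] at cE
  simp only [card_vertImage] at cV
  set s : ℝ := (p : ℝ) * (1 - p)
  have hXY : (n : ℝ) ^ ε * δ ^ K * δ ^ K
      -- Both triple parts lie in copies of `M`, so its density condition suffices; a nonempty one
      -- supplies `n ^ ε`.
      ≤ ((n : ℝ) ^ (tripleVerts φ₁ φ₂ ψ₁ ψ₂).card * s ^ (tripleEdges φ₁ φ₂ ψ₁ ψ₂).card)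
        * ((n : ℝ) ^ (tripleVerts φ₂ φ₁ ψ₂ ψ₁).card * s ^ (tripleEdges φ₂ φ₁ ψ₂ ψ₁).card) := by
    rcases htr with htr | htr
    · exact mul_le_mul (le_density_triple hδ hp' hMK h htr)
        (pow_density_triple_le hδ hp' hn hε hMK h) (by positivity) (by positivity)
    · rw [show (n : ℝ) ^ ε * δ ^ K * δ ^ K = δ ^ K * ((n : ℝ) ^ ε * δ ^ K) by ring]
      exact mul_le_mul (pow_density_triple_le hδ hp' hn hε hMK h)
        (le_density_triple hδ hp' hMK h htr) (by positivity) (by positivity)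
  -- The double counts `cE` and `cV` involve twice the union. Comparing squares uses them directly
  -- and turns `n ^ ε` into `n ^ (ε / 2)`.
  refine le_of_sq_le_sq ?_ (by positivity)
  have hsq : ((n : ℝ) ^ (ε / 2)) ^ 2 = (n : ℝ) ^ ε := by
    rw [← Real.rpow_natCast, ← Real.rpow_mul (by positivity)]; norm_num
  calc (s ^ (unionEdges φ₁ φ₂ ψ₁ ψ₂).card
        * (n : ℝ) ^ (unionVerts φ₁ φ₂ ψ₁ ψ₂).card * ((n : ℝ) ^ (ε / 2) * δ ^ K)) ^ 2
      = (s ^ (2 * (unionEdges φ₁ φ₂ ψ₁ ψ₂).card) * (n : ℝ) ^ (2 * (unionVerts φ₁ φ₂ ψ₁ ψ₂).card))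
        * ((n : ℝ) ^ ε * δ ^ K * δ ^ K) := by rw [← hsq]; ring
    _ ≤ (s ^ (2 * (unionEdges φ₁ φ₂ ψ₁ ψ₂).card) * (n : ℝ) ^ (2 * (unionVerts φ₁ φ₂ ψ₁ ψ₂).card))
        * (((n : ℝ) ^ (tripleVerts φ₁ φ₂ ψ₁ ψ₂).card * s ^ (tripleEdges φ₁ φ₂ ψ₁ ψ₂).card)
        * ((n : ℝ) ^ (tripleVerts φ₂ φ₁ ψ₂ ψ₁).card * s ^ (tripleEdges φ₂ φ₁ ψ₂ ψ₁).card)) :=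
        mul_le_mul_of_nonneg_left hXY (by positivity)
    _ = s ^ (2 * (unionEdges φ₁ φ₂ ψ₁ ψ₂).card + (tripleEdges φ₁ φ₂ ψ₁ ψ₂).card
          + (tripleEdges φ₂ φ₁ ψ₂ ψ₁).card)
        * (n : ℝ) ^ (2 * (unionVerts φ₁ φ₂ ψ₁ ψ₂).card + (tripleVerts φ₁ φ₂ ψ₁ ψ₂).card
          + (tripleVerts φ₂ φ₁ ψ₂ ψ₁).card) := by ring
    _ = s ^ (M.e + N.e + M.e + N.e) * (n : ℝ) ^ (M.v + N.v + M.v + N.v) := by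
        rw [cE, cV]; rfl
    _ = _ := by ring

/-! ### Products of edge moments over four copies -/

variable (p ρ : I)

lemma prod_moment_eq_zero (hcov : ¬ IsCovering φ₁ φ₂ ψ₁ ψ₂) :
    ∏ e, moment p ρ (mult (edgeImage M φ₁) (edgeImage N ψ₁) e)
      (mult (edgeImage M φ₂) (edgeImage N ψ₂) e) = 0 := by
  simp only [IsCovering, not_forall, not_not] at hcov
  obtain ⟨e, he⟩ := hcov
  refine Finset.prod_eq_zero (Finset.mem_univ e) ?_
  rcases Nat.add_eq_one_iff.1 he with ⟨h1, h2⟩ | ⟨h1, h2⟩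
  · rw [h1, h2, moment_zero_one]
  · rw [h1, h2, moment_one_zero]

lemma prod_moment_le_of_isCovering (hcov : IsCovering φ₁ φ₂ ψ₁ ψ₂) :
    ∏ e, moment p ρ (mult (edgeImage M φ₁) (edgeImage N ψ₁) e)
      (mult (edgeImage M φ₂) (edgeImage N ψ₂) e)
      ≤ ((p : ℝ) * (1 - p)) ^ (unionEdges φ₁ φ₂ ψ₁ ψ₂).card := by
  refine (le_abs_self _).trans ?_
  rw [Finset.abs_prod, ← prod_pow_mem_eq]
  refine Finset.prod_le_prod (fun _ _ => abs_nonneg _) fun e _ => ?_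
  have hc := hcov e
  split_ifs with h
  · refine abs_moment_le p ρ (mult_le_two _ _ _) (mult_le_two _ _ _) ?_
    simp only [unionEdges, Finset.mem_union] at h
    simp only [mult] at hc ⊢
    grind
  · simp only [unionEdges, Finset.mem_union, not_or] at h
    simp [mult, h.1.1, h.1.2, h.2.1, h.2.2, moment_zero_zero]

end Quadruple

lemma prod_moment_eq_pow {n : ℕ} (p ρ : I) {A B : Finset (Sym2 (Fin n))} (h : Disjoint A B)
    {i j : ℕ} (c : ℝ) (f g : Sym2 (Fin n) → ℕ) (hc : moment p ρ i j = c)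
    (hf : ∀ e, f e = if e ∈ A ∪ B then i else 0) (hg : ∀ e, g e = if e ∈ A ∪ B then j else 0) :
    ∏ e, moment p ρ (f e) (g e) = c ^ (A.card + B.card) := by
  rw [← Finset.card_union_of_disjoint h, ← prod_pow_mem_eq]
  refine Finset.prod_congr rfl fun e _ => ?_
  rw [hf, hg]
  split_ifs
  · exact hc
  · exact moment_zero_zero p ρ

/-- For pairings that match copies across the two graphs: each covered edge carries one bit of each
graph. The case `B = D = ∅` gives the mean. -/
lemma prod_moment_of_eq_cross {n : ℕ} (p ρ : I) {A B C D : Finset (Sym2 (Fin n))}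
    (h : Disjoint A B) (hAB : A ∪ B = C ∪ D) (h' : Disjoint C D) :
    ∏ e, moment p ρ (mult A B e) (mult C D e)
      = ((ρ : ℝ) * (p * (1 - p))) ^ (A.card + B.card) := by
  refine prod_moment_eq_pow p ρ h (i := 1) (j := 1) _ _ _ (moment_one_one p ρ) (fun e => ?_)
    (fun e => ?_)
  · have hd : e ∈ A → e ∉ B := fun he => Finset.disjoint_left.1 h he
    simp only [mult, Finset.mem_union]; grind
  · have hd : e ∈ C → e ∉ D := fun he => Finset.disjoint_left.1 h' he
    simp only [mult, hAB, Finset.mem_union]; grind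

/-- For the pairing inside each graph: a covered edge carries one bit squared, so the correlation
does not enter. -/
lemma prod_moment_of_eq_same {n : ℕ} (p ρ : I) {A C : Finset (Sym2 (Fin n))}
    (h : Disjoint A C) :
    ∏ e, moment p ρ (mult A A e) (mult C C e) = ((p : ℝ) * (1 - p)) ^ (A.card + C.card) := by
  rw [← Finset.card_union_of_disjoint h, ← prod_pow_mem_eq]
  refine Finset.prod_congr rfl fun e _ => ?_
  have hd : e ∈ A → e ∉ C := fun he => Finset.disjoint_left.1 h he
  by_cases h1 : e ∈ A <;> by_cases h2 : e ∈ C <;>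
    simp_all [mult, moment_two_zero, moment_zero_two, moment_zero_zero]

/-! ### Counting quadruples by the size of their union -/

/-- Among all functions, those with a small image carry little weight. -/
lemma sum_inv_pow_card_image_le (n : ℕ) (hn : 1 ≤ n) (ι : Type) [Fintype ι] [DecidableEq ι] :
    ∑ g : ι → Fin n, ((n : ℝ) ^ (Finset.univ.image g).card)⁻¹
      ≤ (Fintype.card ι).factorial := by
  have hn0 : (0 : ℝ) < n := by exact_mod_cast hn
  have key : ∀ m : ℕ, ∑ g : Fin m → Fin n, ((n : ℝ) ^ (Finset.univ.image g).card)⁻¹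
      ≤ m.factorial := by
    intro m
    induction m with
    | zero => simp
    | succ m ih =>
      rw [← (Fin.consEquiv fun _ => Fin n).sum_comp, Fintype.sum_prod_type_right,
        Nat.factorial_succ, Nat.cast_mul]
      have him : ∀ (x : Fin n) (g : Fin m → Fin n),
          Finset.univ.image ((Fin.consEquiv fun _ => Fin n) (x, g))
            = insert x (Finset.univ.image g) := by
        intro x g
        ext w
        simp [Fin.exists_fin_succ, Fin.consEquiv, eq_comm]
      calc ∑ g : Fin m → Fin n, ∑ x : Fin n,
            ((n : ℝ) ^ (Finset.univ.image ((Fin.consEquiv fun _ => Fin n) (x, g))).card)⁻¹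
          ≤ ∑ g : Fin m → Fin n,
            ((m + 1 : ℕ) : ℝ) * ((n : ℝ) ^ (Finset.univ.image g).card)⁻¹ := by
            refine Finset.sum_le_sum fun g _ => ?_
            simp only [him]
            set S := Finset.univ.image g
            have hS : S.card ≤ m := Finset.card_image_le.trans (by simp)
            -- The new value either lies in `S`, at no cost, or is one of at most `n` values costing
            -- `1/n` each. This gives the factor `|S| + 1 ≤ m + 1`.
            calc ∑ x : Fin n, ((n : ℝ) ^ (insert x S).card)⁻¹
                ≤ ∑ x : Fin n, ((if x ∈ S then ((n : ℝ) ^ S.card)⁻¹ else 0)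
                    + ((n : ℝ) ^ (S.card + 1))⁻¹) := by
                  refine Finset.sum_le_sum fun x _ => ?_
                  by_cases hx : x ∈ S
                  · simp only [Finset.insert_eq_of_mem hx, hx, if_true]
                    exact le_add_of_nonneg_right (by positivity)
                  · simp [hx]
              _ = (S.card + 1 : ℝ) * ((n : ℝ) ^ S.card)⁻¹ := by
                  rw [Finset.sum_add_distrib, ← Finset.sum_filter, Finset.sum_const,
                    Finset.sum_const]
                  simp only [Finset.filter_univ_mem, nsmul_eq_mul, Finset.card_univ,
                    Fintype.card_fin]
                  field_simp
                  ring
              _ ≤ _ := by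
                  push_cast
                  gcongr
        _ ≤ _ := by
            rw [← Finset.mul_sum]
            gcongr
  have := key (Fintype.card ι)
  refine le_trans (le_of_eq ?_) this
  refine Fintype.sum_equiv ((Fintype.equivFin ι).arrowCongr (Equiv.refl _)) _ _ fun g => ?_
  congr 3
  ext w
  simp only [Finset.mem_image, Finset.mem_univ, true_and, Equiv.arrowCongr_apply,
    Equiv.coe_refl, Function.comp_apply, id_eq]
  exact ⟨fun ⟨a, h⟩ => ⟨Fintype.equivFin ι a, by simpa using h⟩, fun ⟨a, h⟩ => ⟨_, h⟩⟩

/-- A quadruple is a function on the disjoint union of the four vertex sets, with image the union of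
the copies; the sum is then enlarged to all functions. -/
lemma sum_inv_pow_card_unionVerts_le (n : ℕ) (hn : 1 ≤ n) (M N : Motif) :
    ∑ x : ((Fin M.v ↪ Fin n) × (Fin M.v ↪ Fin n)) × ((Fin N.v ↪ Fin n) × (Fin N.v ↪ Fin n)),
      ((n : ℝ) ^ (unionVerts x.1.1 x.1.2 x.2.1 x.2.2).card)⁻¹
      ≤ (2 * (M.v + N.v)).factorial := by
  have hcard : Fintype.card ((Fin M.v ⊕ Fin M.v) ⊕ (Fin N.v ⊕ Fin N.v)) = 2 * (M.v + N.v) := by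
    simp; ring
  have h := sum_inv_pow_card_image_le n hn ((Fin M.v ⊕ Fin M.v) ⊕ (Fin N.v ⊕ Fin N.v))
  rw [hcard] at h
  refine le_trans ?_ h
  let f : ((Fin M.v ↪ Fin n) × (Fin M.v ↪ Fin n)) × ((Fin N.v ↪ Fin n) × (Fin N.v ↪ Fin n)) →
      ((Fin M.v ⊕ Fin M.v) ⊕ (Fin N.v ⊕ Fin N.v)) → Fin n :=
    fun x => Sum.elim (Sum.elim x.1.1 x.1.2) (Sum.elim x.2.1 x.2.2)
  have hf : Function.Injective f := by
    rintro ⟨⟨a, b⟩, ⟨c, d⟩⟩ ⟨⟨a', b'⟩, ⟨c', d'⟩⟩ hx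
    have h1 : a = a' := by ext i; exact congrArg Fin.val (congrFun hx (Sum.inl (Sum.inl i)))
    have h2 : b = b' := by ext i; exact congrArg Fin.val (congrFun hx (Sum.inl (Sum.inr i)))
    have h3 : c = c' := by ext i; exact congrArg Fin.val (congrFun hx (Sum.inr (Sum.inl i)))
    have h4 : d = d' := by ext i; exact congrArg Fin.val (congrFun hx (Sum.inr (Sum.inr i)))
    subst h1 h2 h3 h4; rfl
  calc _ = ∑ x, ((n : ℝ) ^ (Finset.univ.image (f x)).card)⁻¹ := by
        refine Finset.sum_congr rfl fun x _ => ?_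
        congr 3
        ext w
        simp only [unionVerts, Finset.mem_union, mem_vertImage, Finset.mem_image, Finset.mem_univ,
          true_and, Sum.exists, f, Sum.elim_inl, Sum.elim_inr]
        tauto
    _ = ∑ g ∈ Finset.univ.map ⟨f, hf⟩, ((n : ℝ) ^ (Finset.univ.image g).card)⁻¹ := by
        rw [Finset.sum_map]; rfl
    _ ≤ _ := Finset.sum_le_sum_of_subset_of_nonneg (Finset.subset_univ _)
        fun _ _ _ => by positivity

/-! ### Moments of the statistic -/

/-- The law of the pairs of bits that the correlated pair of graphs is built from. -/
noncomputable abbrev bitLaw (n : ℕ) (p ρ : I) : Measure (Sym2 (Fin n) → Bool × Bool) :=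
  Measure.pi fun _ : Sym2 (Fin n) => correlatedBernoulli p ρ

/-- The number of pairs of a copy of `M` and a copy of `N` with the same edges. -/
noncomputable def coincidences (n : ℕ) (M N : Motif) : ℝ :=
  ∑ x : (Fin M.v ↪ Fin n) × (Fin N.v ↪ Fin n),
    if edgeImage M x.1 = edgeImage N x.2 then 1 else 0

/-- The weight of a motif in the test statistic. -/
noncomputable def weight (n : ℕ) (p ρ : I) (M : Motif) : ℝ :=
  (ρ : ℝ) ^ M.e / (coincidences n M M * ((p : ℝ) * (1 - p)) ^ M.e)

lemma coincidences_nonneg (n : ℕ) (M N : Motif) : 0 ≤ coincidences n M N :=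
  Finset.sum_nonneg fun _ _ => by split_ifs <;> norm_num

/-- Only the pairs `(φ, φ)` are kept. -/
lemma descFactorial_le_coincidences (n : ℕ) (M : Motif) :
    (n.descFactorial M.v : ℝ) ≤ coincidences n M M := by
  have h : (n.descFactorial M.v : ℝ) = ∑ _φ : Fin M.v ↪ Fin n, (1 : ℝ) := by
    simp [Fintype.card_embedding_eq]
  rw [h, coincidences, Fintype.sum_prod_type]
  refine Finset.sum_le_sum fun φ _ => ?_
  refine le_trans ?_ (Finset.single_le_sum (fun ψ _ => ?_) (Finset.mem_univ φ))
  · simp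
  · dsimp only; split_ifs <;> norm_num

lemma coincidences_eq_zero {n : ℕ} {F : Finset Motif} (hF : IsMotifFamily F)
    (hconn : ∀ M ∈ F, M.graph.Connected) (he : ∀ M ∈ F, 1 ≤ M.e) {M N : Motif} (hM : M ∈ F)
    (hN : N ∈ F) (hMN : M ≠ N) : coincidences n M N = 0 := by
  refine Finset.sum_eq_zero fun x _ => if_neg fun h => hMN ?_
  exact hF M hM N hN
    (nonempty_iso_of_edgeImage_eq (hconn M hM) (hconn N hN) (he M hM) (he N hN) h)

lemma integral_injCount_mul {n : ℕ} (p : I) (M N : Motif) :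
    ∫ G : SimpleGraph (Fin n), injCount M (centered p G) * injCount N (centered p G)
      ∂SimpleGraph.binomialRandom (Fin n) p
      = coincidences n M N * ((p : ℝ) * (1 - p)) ^ M.e := by
  simp only [injCount_centered, Finset.sum_mul_sum, ← Finset.sum_product']
  rw [integral_finsetSum _ fun _ _ => Integrable.of_finite, coincidences, Finset.sum_mul]
  refine Finset.sum_congr rfl fun x _ => ?_
  rw [integral_character_mul p (fun e => not_isDiag_of_mem_edgeImage)
    (fun e => not_isDiag_of_mem_edgeImage), card_edgeImage]
  split_ifs <;> simp

lemma statistic_sq {n : ℕ} (p : I) (F : Finset Motif) (ω : Motif → ℝ)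
    (G : SimpleGraph (Fin n) × SimpleGraph (Fin n)) :
    statistic p F ω G ^ 2 = ∑ M ∈ F, ∑ N ∈ F, ω M * ω N *
      ((injCount M (centered p G.1) * injCount N (centered p G.1))
        * (injCount M (centered p G.2) * injCount N (centered p G.2))) := by
  rw [statistic, sq, Finset.sum_mul_sum]
  exact Finset.sum_congr rfl fun M _ => Finset.sum_congr rfl fun N _ => by ring

section Family

variable {n : ℕ} {p ρ : I} {F : Finset Motif}

/-- The normalisation that motivates the weights: the second factor is the null second moment of
`inj(M)`. The moment computations eliminate the weights through this identity. -/
lemma weight_mul (hp : 0 < (p : ℝ) * (1 - p)) {M : Motif} (hB : 0 < coincidences n M M) :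
    weight n p ρ M * (coincidences n M M * ((p : ℝ) * (1 - p)) ^ M.e) = (ρ : ℝ) ^ M.e := by
  unfold weight
  field_simp

lemma weight_nonneg (p ρ : I) (M : Motif) : 0 ≤ weight n p ρ M :=
  div_nonneg (pow_nonneg ρ.2.1 _)
    (mul_nonneg (coincidences_nonneg n M M) (pow_nonneg (nonneg_mul p) _))

/-- The second moment of the statistic under the null hypothesis. -/
lemma integral_statistic_sq_null (hF : IsMotifFamily F) (hconn : ∀ M ∈ F, M.graph.Connected)
    (he : ∀ M ∈ F, 1 ≤ M.e) (hp : 0 < (p : ℝ) * (1 - p))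
    (hB : ∀ M ∈ F, 0 < coincidences n M M) :
    ∫ G, statistic p F (weight n p ρ) G ^ 2 ∂nullLaw n p = ∑ M ∈ F, (ρ : ℝ) ^ (2 * M.e) := by
  simp only [statistic_sq, nullLaw]
  rw [integral_finsetSum _ fun _ _ => Integrable.of_finite]
  refine Finset.sum_congr rfl fun M hM => ?_
  rw [integral_finsetSum _ fun _ _ => Integrable.of_finite]
  have hterm : ∀ N, ∫ G : SimpleGraph (Fin n) × SimpleGraph (Fin n),
      weight n p ρ M * weight n p ρ N *
      ((injCount M (centered p G.1) * injCount N (centered p G.1))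
        * (injCount M (centered p G.2) * injCount N (centered p G.2)))
      ∂(SimpleGraph.binomialRandom (Fin n) p).prod (SimpleGraph.binomialRandom (Fin n) p)
      = weight n p ρ M * weight n p ρ N
        * (coincidences n M N * ((p : ℝ) * (1 - p)) ^ M.e) ^ 2 := by
    intro N
    rw [integral_const_mul, integral_prod_mul
      (fun G : SimpleGraph (Fin n) => injCount M (centered p G) * injCount N (centered p G))
      (fun G : SimpleGraph (Fin n) => injCount M (centered p G) * injCount N (centered p G)),
      integral_injCount_mul, sq]
  simp only [hterm]
  rw [Finset.sum_eq_single M (fun N hN hne => by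
    rw [coincidences_eq_zero hF hconn he hM hN hne.symm]; ring) (fun h => absurd hM h),
    mul_comm 2, pow_mul, ← weight_mul hp (hB M hM)]
  ring

/-- The expectation of the statistic under the alternative. -/
lemma integral_statistic_alt (hp : 0 < (p : ℝ) * (1 - p))
    (hB : ∀ M ∈ F, 0 < coincidences n M M) :
    ∫ x, statistic p F (weight n p ρ) (graphPair 1 x) ∂bitLaw n p ρ
      = ∑ M ∈ F, (ρ : ℝ) ^ (2 * M.e) := by
  simp only [statistic]
  rw [integral_finsetSum _ fun _ _ => Integrable.of_finite]
  refine Finset.sum_congr rfl fun M hM => ?_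
  simp only [mul_assoc]
  rw [integral_const_mul]
  have h : ∫ x, injCount M (centered p (graphPair 1 x).1)
      * injCount M (centered p (graphPair 1 x).2) ∂bitLaw n p ρ
      = coincidences n M M * ((ρ : ℝ) * (p * (1 - p))) ^ M.e := by
    simp only [injCount_centered, Finset.sum_mul_sum, ← Finset.sum_product']
    rw [integral_finsetSum _ fun _ _ => Integrable.of_finite, coincidences, Finset.sum_mul]
    refine Finset.sum_congr rfl fun x _ => ?_
    have h1 := integral_pi_character p ρ (A₁ := edgeImage M x.1) (B₁ := ∅)
      (A₂ := edgeImage M x.2) (B₂ := ∅) (fun e => not_isDiag_of_mem_edgeImage) (by simp)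
      (fun e => not_isDiag_of_mem_edgeImage) (by simp)
    simp only [character, Finset.prod_empty, mul_one] at h1
    simp only [character]
    rw [h1]
    split_ifs with hx
    · rw [hx, prod_moment_of_eq_cross p ρ (Finset.disjoint_empty_right _) rfl
        (Finset.disjoint_empty_right _), Finset.card_empty, card_edgeImage]
      ring
    · obtain ⟨e, he⟩ : ∃ e, ¬ (e ∈ edgeImage M x.1 ↔ e ∈ edgeImage M x.2) := by
        by_contra! h
        exact hx (Finset.ext h)
      rw [zero_mul]
      refine Finset.prod_eq_zero (Finset.mem_univ e) ?_
      by_cases h1 : e ∈ edgeImage M x.1 <;> by_cases h2 : e ∈ edgeImage M x.2 <;>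
        simp_all [mult, moment_one_zero, moment_zero_one]
  rw [h, mul_pow, mul_comm 2, pow_mul, sq]
  nth_rewrite 3 [← weight_mul hp (hB M hM)]
  ring

end Family

/-! ### Second moment under the alternative -/

/-- Quadruples of two copies of `M` and two copies of `N`. -/
abbrev Quad (n : ℕ) (M N : Motif) : Type :=
  ((Fin M.v ↪ Fin n) × (Fin M.v ↪ Fin n)) × ((Fin N.v ↪ Fin n) × (Fin N.v ↪ Fin n))

open Classical in
/-- The bound on the contribution of a quadruple with a vertex common to three copies. -/
noncomputable def overlapTerm {n : ℕ} (p : I) {M N : Motif} (φ₁ φ₂ : Fin M.v ↪ Fin n)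
    (ψ₁ ψ₂ : Fin N.v ↪ Fin n) : ℝ :=
  if IsCovering φ₁ φ₂ ψ₁ ψ₂ ∧ HasTriple φ₁ φ₂ ψ₁ ψ₂
  then ((p : ℝ) * (1 - p)) ^ (unionEdges φ₁ φ₂ ψ₁ ψ₂).card else 0

lemma overlapTerm_nonneg {n : ℕ} (p : I) {M N : Motif} (φ₁ φ₂ : Fin M.v ↪ Fin n)
    (ψ₁ ψ₂ : Fin N.v ↪ Fin n) : 0 ≤ overlapTerm p φ₁ φ₂ ψ₁ ψ₂ := by
  unfold overlapTerm
  split_ifs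
  · exact pow_nonneg (nonneg_mul p) _
  · exact le_rfl

/-- The contribution of the quadruples with a vertex common to three copies. -/
noncomputable def overlapWeight (n : ℕ) (p : I) (M N : Motif) : ℝ :=
  ∑ x : Quad n M N, overlapTerm p x.1.1 x.1.2 x.2.1 x.2.2

/-- One nonnegative term for each pairing and one for triple overlaps; the product vanishes unless
the quadruple is covering. In the crossed pairing `ρ` is bounded by 1, so that it costs as much as
the parallel one. -/
lemma prod_moment_le {n : ℕ} (p ρ : I) {M N : Motif} (hM : M.graph.Connected)
    (hN : N.graph.Connected) (heM : 1 ≤ M.e) (heN : 1 ≤ N.e)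
    (φ₁ φ₂ : Fin M.v ↪ Fin n) (ψ₁ ψ₂ : Fin N.v ↪ Fin n) :
    ∏ e, moment p ρ (mult (edgeImage M φ₁) (edgeImage N ψ₁) e)
      (mult (edgeImage M φ₂) (edgeImage N ψ₂) e)
    ≤ ((ρ : ℝ) * (p * (1 - p))) ^ (M.e + N.e)
        * ((if edgeImage M φ₁ = edgeImage M φ₂ then 1 else 0)
          * (if edgeImage N ψ₁ = edgeImage N ψ₂ then 1 else 0))
      + ((p : ℝ) * (1 - p)) ^ (M.e + N.e)
        * ((if edgeImage M φ₁ = edgeImage N ψ₁ then 1 else 0)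
          * (if edgeImage M φ₂ = edgeImage N ψ₂ then 1 else 0))
      + ((p : ℝ) * (1 - p)) ^ (M.e + N.e)
        * ((if edgeImage M φ₁ = edgeImage N ψ₂ then 1 else 0)
          * (if edgeImage M φ₂ = edgeImage N ψ₁ then 1 else 0))
      + overlapTerm p φ₁ φ₂ ψ₁ ψ₂ := by
  have hs := nonneg_mul p
  have hρ : (0 : ℝ) ≤ ρ := ρ.2.1
  have i0 : ∀ (P : Prop) [Decidable P], (0 : ℝ) ≤ if P then 1 else 0 :=
    fun P _ => by split_ifs <;> norm_num
  have t1 : 0 ≤ ((ρ : ℝ) * (p * (1 - p))) ^ (M.e + N.e)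
        * ((if edgeImage M φ₁ = edgeImage M φ₂ then 1 else 0)
          * (if edgeImage N ψ₁ = edgeImage N ψ₂ then 1 else 0)) :=
    mul_nonneg (by positivity) (mul_nonneg (i0 _) (i0 _))
  have t2 : 0 ≤ ((p : ℝ) * (1 - p)) ^ (M.e + N.e)
        * ((if edgeImage M φ₁ = edgeImage N ψ₁ then 1 else 0)
          * (if edgeImage M φ₂ = edgeImage N ψ₂ then 1 else 0)) :=
    mul_nonneg (by positivity) (mul_nonneg (i0 _) (i0 _))
  have t3 : 0 ≤ ((p : ℝ) * (1 - p)) ^ (M.e + N.e)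
        * ((if edgeImage M φ₁ = edgeImage N ψ₂ then 1 else 0)
          * (if edgeImage M φ₂ = edgeImage N ψ₁ then 1 else 0)) :=
    mul_nonneg (by positivity) (mul_nonneg (i0 _) (i0 _))
  have t4 := overlapTerm_nonneg p φ₁ φ₂ ψ₁ ψ₂
  by_cases hcov : IsCovering φ₁ φ₂ ψ₁ ψ₂
  swap
  · rw [prod_moment_eq_zero p ρ hcov]
    linarith
  by_cases htr : HasTriple φ₁ φ₂ ψ₁ ψ₂
  · have h := prod_moment_le_of_isCovering p ρ hcov
    have h' : overlapTerm p φ₁ φ₂ ψ₁ ψ₂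
        = ((p : ℝ) * (1 - p)) ^ (unionEdges φ₁ φ₂ ψ₁ ψ₂).card := if_pos ⟨hcov, htr⟩
    linarith
  rcases pairing_of_isCovering hM hN heM heN hcov htr with ⟨h1, h2, hd⟩ | ⟨h1, h2, hd⟩ | ⟨h1, h2, hd⟩
  · rw [if_pos h1, if_pos h2] at t2 ⊢
    have hcard : N.e = M.e := by rw [← card_edgeImage M φ₁, h1, card_edgeImage]
    have : ∏ e, moment p ρ (mult (edgeImage M φ₁) (edgeImage N ψ₁) e)
        (mult (edgeImage M φ₂) (edgeImage N ψ₂) e) = ((p : ℝ) * (1 - p)) ^ (M.e + N.e) := by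
      rw [← h1, ← h2, prod_moment_of_eq_same p ρ hd, card_edgeImage, card_edgeImage, hcard]
    rw [this]
    linarith
  · rw [if_pos h1, if_pos h2] at t1 ⊢
    have : ∏ e, moment p ρ (mult (edgeImage M φ₁) (edgeImage N ψ₁) e)
        (mult (edgeImage M φ₂) (edgeImage N ψ₂) e)
        = ((ρ : ℝ) * (p * (1 - p))) ^ (M.e + N.e) := by
      rw [← h1, ← h2, prod_moment_of_eq_cross p ρ hd rfl hd, card_edgeImage, card_edgeImage]
    rw [this]
    linarith
  · rw [if_pos h1, if_pos h2.symm] at t3 ⊢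
    have : ∏ e, moment p ρ (mult (edgeImage M φ₁) (edgeImage N ψ₁) e)
        (mult (edgeImage M φ₂) (edgeImage N ψ₂) e)
        = ((ρ : ℝ) * (p * (1 - p))) ^ (M.e + N.e) := by
      rw [← h1, ← h2, prod_moment_of_eq_cross p ρ hd (Finset.union_comm _ _) hd.symm,
        card_edgeImage, card_edgeImage]
    rw [this]
    have : ((ρ : ℝ) * (p * (1 - p))) ^ (M.e + N.e) ≤ ((p : ℝ) * (1 - p)) ^ (M.e + N.e) :=
      pow_le_pow_left₀ (by positivity) (mul_le_of_le_one_left hs ρ.2.2) _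
    linarith

lemma sum_quad_same {n : ℕ} (M N : Motif) :
    ∑ x : Quad n M N, (if edgeImage M x.1.1 = edgeImage M x.1.2 then (1 : ℝ) else 0)
          * (if edgeImage N x.2.1 = edgeImage N x.2.2 then 1 else 0)
      = coincidences n M M * coincidences n N N := by
  rw [coincidences, coincidences, Finset.sum_mul_sum, Fintype.sum_prod_type]

lemma sum_quad_parallel {n : ℕ} (M N : Motif) :
    ∑ x : Quad n M N, (if edgeImage M x.1.1 = edgeImage N x.2.1 then (1 : ℝ) else 0)
          * (if edgeImage M x.1.2 = edgeImage N x.2.2 then 1 else 0)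
      = coincidences n M N * coincidences n M N := by
  rw [coincidences, Finset.sum_mul_sum, ← Fintype.sum_prod_type']
  exact Fintype.sum_equiv (Equiv.prodProdProdComm _ _ _ _) _ _ fun x => rfl

lemma sum_quad_crossed {n : ℕ} (M N : Motif) :
    ∑ x : Quad n M N, (if edgeImage M x.1.1 = edgeImage N x.2.2 then (1 : ℝ) else 0)
          * (if edgeImage M x.1.2 = edgeImage N x.2.1 then 1 else 0)
      = coincidences n M N * coincidences n M N := by
  rw [← sum_quad_parallel]
  exact Fintype.sum_equiv (Equiv.prodCongr (Equiv.refl _) (Equiv.prodComm _ _)) _ _ fun x => rfl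

lemma integral_injCount_quad_le {n : ℕ} (p ρ : I) {M N : Motif} (hM : M.graph.Connected)
    (hN : N.graph.Connected) (heM : 1 ≤ M.e) (heN : 1 ≤ N.e) :
    ∫ x, (injCount M (centered p (graphPair 1 x).1) * injCount N (centered p (graphPair 1 x).1))
        * (injCount M (centered p (graphPair 1 x).2) * injCount N (centered p (graphPair 1 x).2))
        ∂bitLaw n p ρ
      ≤ ((ρ : ℝ) * (p * (1 - p))) ^ (M.e + N.e) * (coincidences n M M * coincidences n N N)
        + 2 * (((p : ℝ) * (1 - p)) ^ (M.e + N.e) * (coincidences n M N * coincidences n M N))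
        + overlapWeight n p M N := by
  have hexp : ∀ x, (injCount M (centered p (graphPair 1 x).1)
        * injCount N (centered p (graphPair 1 x).1))
        * (injCount M (centered p (graphPair 1 x).2) * injCount N (centered p (graphPair 1 x).2))
      = ∑ q : Quad n M N,
        character p (edgeImage M q.1.1) (graphPair 1 x).1
          * character p (edgeImage N q.2.1) (graphPair 1 x).1
          * (character p (edgeImage M q.1.2) (graphPair 1 x).2
          * character p (edgeImage N q.2.2) (graphPair 1 x).2) := by
    intro x
    rw [mul_mul_mul_comm]
    simp only [injCount_centered]
    simp only [Finset.sum_mul_sum, ← Fintype.sum_prod_type']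
    refine Finset.sum_congr rfl fun q _ => by ring
  simp only [hexp]
  rw [integral_finsetSum _ fun _ _ => Integrable.of_finite]
  rw [Finset.sum_congr rfl fun q _ => integral_pi_character p ρ
    (A₁ := edgeImage M q.1.1) (B₁ := edgeImage N q.2.1) (A₂ := edgeImage M q.1.2)
    (B₂ := edgeImage N q.2.2) (fun e he => not_isDiag_of_mem_edgeImage he)
    (fun e he => not_isDiag_of_mem_edgeImage he) (fun e he => not_isDiag_of_mem_edgeImage he)
    (fun e he => not_isDiag_of_mem_edgeImage he)]
  refine (Finset.sum_le_sum fun q _ =>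
    prod_moment_le p ρ hM hN heM heN q.1.1 q.1.2 q.2.1 q.2.2).trans (le_of_eq ?_)
  rw [Finset.sum_add_distrib, Finset.sum_add_distrib, Finset.sum_add_distrib,
    ← Finset.mul_sum, ← Finset.mul_sum, ← Finset.mul_sum, sum_quad_same, sum_quad_parallel,
    sum_quad_crossed, overlapWeight]
  ring

/-- The second moment of the statistic under the alternative. -/
lemma integral_statistic_sq_alt_le {n : ℕ} {p ρ : I} {F : Finset Motif} (hF : IsMotifFamily F)
    (hconn : ∀ M ∈ F, M.graph.Connected) (he : ∀ M ∈ F, 1 ≤ M.e) (hp : 0 < (p : ℝ) * (1 - p))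
    (hB : ∀ M ∈ F, 0 < coincidences n M M) {η : ℝ}
    (hη : ∀ M ∈ F, ∀ N ∈ F, overlapWeight n p M N
      ≤ η * ((ρ : ℝ) ^ (M.e + N.e) * ((coincidences n M M * ((p : ℝ) * (1 - p)) ^ M.e)
        * (coincidences n N N * ((p : ℝ) * (1 - p)) ^ N.e)))) :
    ∫ x, statistic p F (weight n p ρ) (graphPair 1 x) ^ 2 ∂bitLaw n p ρ
      ≤ (1 + η) * (∑ M ∈ F, (ρ : ℝ) ^ (2 * M.e)) ^ 2 + 2 * ∑ M ∈ F, (ρ : ℝ) ^ (2 * M.e) := by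
  classical
  simp only [statistic_sq]
  rw [integral_finsetSum _ fun _ _ => Integrable.of_finite, sq, Finset.sum_mul_sum,
    Finset.mul_sum, Finset.mul_sum, ← Finset.sum_add_distrib]
  refine Finset.sum_le_sum fun M hM => ?_
  rw [integral_finsetSum _ fun _ _ => Integrable.of_finite]
  -- Spreading the linear term over the diagonal `N = M` allows a comparison term by term in `(M,
  -- N)`.
  have hd : 2 * (ρ : ℝ) ^ (2 * M.e) = ∑ N ∈ F, if N = M then 2 * (ρ : ℝ) ^ (2 * M.e) else 0 := by
    rw [Finset.sum_ite_eq' F M, if_pos hM]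
  rw [hd, Finset.mul_sum, ← Finset.sum_add_distrib]
  refine Finset.sum_le_sum fun N hN => ?_
  rw [integral_const_mul]
  have hw : 0 ≤ weight n p ρ M * weight n p ρ N :=
    mul_nonneg (weight_nonneg p ρ M) (weight_nonneg p ρ N)
  refine (mul_le_mul_of_nonneg_left (integral_injCount_quad_le p ρ (hconn M hM) (hconn N hN)
    (he M hM) (he N hN)) hw).trans ?_
  have wM := weight_mul (ρ := ρ) hp (hB M hM)
  have wN := weight_mul (ρ := ρ) hp (hB N hN)
  have h1 : weight n p ρ M * weight n p ρ N * (((ρ : ℝ) * (p * (1 - p))) ^ (M.e + N.e)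
      * (coincidences n M M * coincidences n N N)) = (ρ : ℝ) ^ (2 * M.e) * (ρ : ℝ) ^ (2 * N.e) := by
    rw [mul_comm 2, pow_mul, mul_comm 2, pow_mul, sq, sq]
    calc _ = (ρ : ℝ) ^ M.e * (ρ : ℝ) ^ N.e
          * (weight n p ρ M * (coincidences n M M * ((p : ℝ) * (1 - p)) ^ M.e))
          * (weight n p ρ N * (coincidences n N N * ((p : ℝ) * (1 - p)) ^ N.e)) := by
          rw [mul_pow, pow_add, pow_add]; ring
      _ = _ := by rw [wM, wN]; ring
  have h2 : weight n p ρ M * weight n p ρ N * (2 * (((p : ℝ) * (1 - p)) ^ (M.e + N.e)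
      * (coincidences n M N * coincidences n M N)))
      = if N = M then 2 * (ρ : ℝ) ^ (2 * M.e) else 0 := by
    split_ifs with hMN
    · subst hMN
      rw [mul_comm 2 N.e, pow_mul, ← wN]; ring
    · rw [coincidences_eq_zero hF hconn he hM hN (Ne.symm hMN)]; ring
  have h3 : weight n p ρ M * weight n p ρ N * overlapWeight n p M N
      ≤ η * ((ρ : ℝ) ^ (2 * M.e) * (ρ : ℝ) ^ (2 * N.e)) := by
    refine (mul_le_mul_of_nonneg_left (hη M hM N hN) hw).trans (le_of_eq ?_)
    rw [mul_comm 2, pow_mul, mul_comm 2, pow_mul, sq, sq, pow_add]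
    calc _ = η * ((ρ : ℝ) ^ M.e * (ρ : ℝ) ^ N.e)
          * (weight n p ρ M * (coincidences n M M * ((p : ℝ) * (1 - p)) ^ M.e))
          * (weight n p ρ N * (coincidences n N N * ((p : ℝ) * (1 - p)) ^ N.e)) := by ring
      _ = _ := by rw [wM, wN]; ring
  rw [mul_add, mul_add, h1, h2]
  linarith

/-! ### Overlapping quadruples are negligible -/

/-- Isolates `n ^ (-|V|)`, the only factor that depends on the quadruple, ready for summation. -/
lemma overlapTerm_le {n : ℕ} {p : I} {M N : Motif} {ε δ : ℝ} {K : ℕ} (hδ : 0 < δ)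
    (hp' : (p : ℝ) ≤ 1 - δ) (hn : 1 ≤ n) (hε : 0 ≤ ε) (hMK : M.e ≤ K)
    (hM : M.graph.Connected) (hN : N.graph.Connected) (heM : 1 ≤ M.e) (heN : 1 ≤ N.e)
    (h : ∀ M' : M.graph.Subgraph, M'.verts.Nonempty →
      (n : ℝ) ^ ε ≤ (n : ℝ) ^ M'.verts.ncard * (p : ℝ) ^ M'.edgeSet.ncard)
    (φ₁ φ₂ : Fin M.v ↪ Fin n) (ψ₁ ψ₂ : Fin N.v ↪ Fin n) :
    overlapTerm p φ₁ φ₂ ψ₁ ψ₂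
      ≤ ((p : ℝ) * (1 - p)) ^ (M.e + N.e) * (n : ℝ) ^ (M.v + N.v) / ((n : ℝ) ^ (ε / 2) * δ ^ K)
        * ((n : ℝ) ^ (unionVerts φ₁ φ₂ ψ₁ ψ₂).card)⁻¹ := by
  have hs := nonneg_mul p
  have hn0 : (0 : ℝ) < n := by exact_mod_cast hn
  have hD : 0 < (n : ℝ) ^ (ε / 2) * δ ^ K := by positivity
  unfold overlapTerm
  split_ifs with hx
  · rw [← div_eq_mul_inv, le_div_iff₀ (by positivity), le_div_iff₀ hD]
    exact weight_le_of_hasTriple hδ hp' hn hε hMK hM hN heM heN h hx.1 hx.2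
  · positivity

lemma overlapWeight_le {n : ℕ} {p : I} {M N : Motif} {ε δ : ℝ} {K : ℕ} (hδ : 0 < δ)
    (hp' : (p : ℝ) ≤ 1 - δ) (hn : 1 ≤ n) (hε : 0 ≤ ε) (hMK : M.e ≤ K)
    (hM : M.graph.Connected) (hN : N.graph.Connected) (heM : 1 ≤ M.e) (heN : 1 ≤ N.e)
    (h : ∀ M' : M.graph.Subgraph, M'.verts.Nonempty →
      (n : ℝ) ^ ε ≤ (n : ℝ) ^ M'.verts.ncard * (p : ℝ) ^ M'.edgeSet.ncard) :
    overlapWeight n p M N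
      ≤ ((p : ℝ) * (1 - p)) ^ (M.e + N.e) * (n : ℝ) ^ (M.v + N.v) / ((n : ℝ) ^ (ε / 2) * δ ^ K)
        * (2 * (M.v + N.v)).factorial := by
  have hs := nonneg_mul p
  refine (Finset.sum_le_sum fun x _ => overlapTerm_le hδ hp' hn hε hMK hM hN heM heN h
    x.1.1 x.1.2 x.2.1 x.2.2).trans ?_
  rw [← Finset.mul_sum]
  exact mul_le_mul_of_nonneg_left (sum_inv_pow_card_unionVerts_le n hn M N) (by positivity)

/-- Each factor of the falling factorial is at least `n / 2`. -/
lemma pow_le_two_pow_mul_coincidences {n K : ℕ} (M : Motif) (hv : M.v ≤ K) (hK : 2 * K ≤ n) :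
    (n : ℝ) ^ M.v ≤ 2 ^ K * coincidences n M M := by
  have h1 : n ^ M.v ≤ 2 ^ K * n.descFactorial M.v := by
    calc n ^ M.v ≤ (2 * (n + 1 - M.v)) ^ M.v := Nat.pow_le_pow_left (by omega) _
      _ = 2 ^ M.v * (n + 1 - M.v) ^ M.v := mul_pow _ _ _
      _ ≤ 2 ^ K * n.descFactorial M.v := Nat.mul_le_mul
          (Nat.pow_le_pow_right (by norm_num) hv) (Nat.pow_sub_le_descFactorial n M.v)
  calc (n : ℝ) ^ M.v ≤ 2 ^ K * (n.descFactorial M.v : ℝ) := by exact_mod_cast h1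
    _ ≤ _ := by
      have := descFactorial_le_coincidences n M
      gcongr

lemma coincidences_pos {n K : ℕ} (M : Motif) (hn : 1 ≤ n) (hv : M.v ≤ K) (hK : 2 * K ≤ n) :
    0 < coincidences n M M := by
  have h := pow_le_two_pow_mul_coincidences M hv hK
  have hn0 : (0 : ℝ) < n := by exact_mod_cast hn
  have : 0 < (2 : ℝ) ^ K * coincidences n M M := lt_of_lt_of_le (by positivity) h
  exact pos_of_mul_pos_right this (by positivity)

lemma factorial_le_pow_of_le {m K : ℕ} (h : m ≤ K) : m.factorial ≤ K ^ K :=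
  (Nat.factorial_le h).trans K.factorial_le_pow

/-- Quadruples with a vertex common to three copies contribute at most a fraction `η`. -/
lemma overlapWeight_le_mul {n : ℕ} {p ρ : I} {M N : Motif} {ε δ η : ℝ} {K : ℕ} (hδ : 0 < δ)
    (hp' : (p : ℝ) ≤ 1 - δ) (hn : 1 ≤ n) (hε : 0 ≤ ε) (hη : 0 ≤ η) (hMK : M.e ≤ K)
    (hNK : N.e ≤ K) (hMv : M.v ≤ K) (hNv : N.v ≤ K) (hK : 2 * K ≤ n)
    (hM : M.graph.Connected) (hN : N.graph.Connected) (heM : 1 ≤ M.e) (heN : 1 ≤ N.e)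
    (h : ∀ M' : M.graph.Subgraph, M'.verts.Nonempty →
      (n : ℝ) ^ ε ≤ (n : ℝ) ^ M'.verts.ncard * (p : ℝ) ^ M'.edgeSet.ncard)
    (hsmall : (4 : ℝ) ^ K * (4 * K : ℝ) ^ (4 * K)
      ≤ η * (ρ : ℝ) ^ (2 * K) * ((n : ℝ) ^ (ε / 2) * δ ^ K)) :
    overlapWeight n p M N
      ≤ η * ((ρ : ℝ) ^ (M.e + N.e) * ((coincidences n M M * ((p : ℝ) * (1 - p)) ^ M.e)
        * (coincidences n N N * ((p : ℝ) * (1 - p)) ^ N.e))) := by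
  have hs := nonneg_mul p
  have hn0 : (0 : ℝ) < n := by exact_mod_cast hn
  have hD : 0 < (n : ℝ) ^ (ε / 2) * δ ^ K := by positivity
  have hρ0 : (0 : ℝ) ≤ ρ := ρ.2.1
  refine (overlapWeight_le hδ hp' hn hε hMK hM hN heM heN h).trans ?_
  -- In `hsmall`, `(4K)^(4K)` bounds this factorial, `4^K` pays for two falling factorials, and
  -- `ρ^(2K)` for the two motifs.
  have hf : ((2 * (M.v + N.v)).factorial : ℝ) ≤ (4 * K : ℝ) ^ (4 * K) := by
    exact_mod_cast factorial_le_pow_of_le (show 2 * (M.v + N.v) ≤ 4 * K by omega)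
  have hv : (n : ℝ) ^ (M.v + N.v) ≤ 4 ^ K * (coincidences n M M * coincidences n N N) := by
    calc (n : ℝ) ^ (M.v + N.v) = (n : ℝ) ^ M.v * (n : ℝ) ^ N.v := pow_add _ _ _
      _ ≤ (2 ^ K * coincidences n M M) * (2 ^ K * coincidences n N N) :=
          mul_le_mul (pow_le_two_pow_mul_coincidences M hMv hK)
            (pow_le_two_pow_mul_coincidences N hNv hK) (by positivity)
            (mul_nonneg (by positivity) (coincidences_nonneg n M M))
      _ = _ := by rw [show (4 : ℝ) = 2 * 2 by norm_num, mul_pow]; ring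
  have hBB : 0 ≤ coincidences n M M * coincidences n N N :=
    mul_nonneg (coincidences_nonneg n M M) (coincidences_nonneg n N N)
  have hρ : (ρ : ℝ) ^ (2 * K) ≤ (ρ : ℝ) ^ (M.e + N.e) :=
    pow_le_pow_of_le_one hρ0 ρ.2.2 (by omega)
  set s : ℝ := (p : ℝ) * (1 - p)
  set D : ℝ := (n : ℝ) ^ (ε / 2) * δ ^ K
  rw [div_mul_eq_mul_div, div_le_iff₀ hD]
  calc s ^ (M.e + N.e) * (n : ℝ) ^ (M.v + N.v) * ((2 * (M.v + N.v)).factorial : ℝ)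
      ≤ s ^ (M.e + N.e) * (4 ^ K * (coincidences n M M * coincidences n N N))
          * (4 * K : ℝ) ^ (4 * K) := by gcongr
    _ = s ^ (M.e + N.e) * (coincidences n M M * coincidences n N N)
          * ((4 : ℝ) ^ K * (4 * K : ℝ) ^ (4 * K)) := by ring
    _ ≤ s ^ (M.e + N.e) * (coincidences n M M * coincidences n N N)
          * (η * (ρ : ℝ) ^ (M.e + N.e) * D) := by
        refine mul_le_mul_of_nonneg_left (hsmall.trans ?_) (by positivity)
        gcongr
    _ = _ := by rw [pow_add s]; ring

/-! ### Asymptotics -/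

/-- With `L = log n` and `K = ⌊C n⌋₊`, the growth condition gives `K max(log L, -log ρ) ≤ c L`.
Hence `4^K`, `(4K)^(4K)`, `ρ^(-2K)` and `δ^(-K)` are at most `exp` of `1`, `8`, `2` and `1` times `c
L`. -/
lemma eventually_size_bounds {ρ : ℕ → I} {C : ℕ → ℝ} (hρ : ∀ n, 0 < (ρ n : ℝ))
    (hC : C =o[atTop] (fun n : ℕ =>
      Real.log n / max (Real.log (Real.log n)) (-Real.log (ρ n))))
    {ε δ η : ℝ} (hε : 0 < ε) (hδ : 0 < δ) (hη : 0 < η) :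
    ∀ᶠ n : ℕ in atTop, 2 * ⌊C n⌋₊ ≤ n ∧
      (4 : ℝ) ^ ⌊C n⌋₊ * (4 * ⌊C n⌋₊ : ℝ) ^ (4 * ⌊C n⌋₊)
        ≤ η * (ρ n : ℝ) ^ (2 * ⌊C n⌋₊) * ((n : ℝ) ^ (ε / 2) * δ ^ ⌊C n⌋₊) := by
  have hL : Tendsto (fun n : ℕ => Real.log n) atTop atTop :=
    Real.tendsto_log_atTop.comp tendsto_natCast_atTop_atTop
  have hℓ : Tendsto (fun n : ℕ => Real.log (Real.log n)) atTop atTop :=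
    Real.tendsto_log_atTop.comp hL
  -- The losses total `12 c L ≤ (ε/4) L`; the other half of `n ^ (ε/2)` absorbs `η`. The bound `1/2`
  -- gives `2K ≤ L ≤ n`.
  set c : ℝ := min (ε / 48) (1 / 2) with hc
  have hc0 : 0 < c := by positivity
  filter_upwards [hC.bound hc0, hL.eventually_ge_atTop 1, hℓ.eventually_ge_atTop 1,
    hℓ.eventually_ge_atTop (Real.log 4), hℓ.eventually_ge_atTop (-Real.log δ),
    hL.eventually_ge_atTop (-Real.log η / (ε / 4)), eventually_ge_atTop 1]
    with n hCn hL1 hℓ1 hℓ4 hℓδ hLη hn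
  have hn0 : (0 : ℝ) < n := by exact_mod_cast hn
  set K := ⌊C n⌋₊
  set L := Real.log n with hLdef
  set ℓ := Real.log L with hℓdef
  set R := max ℓ (-Real.log (ρ n))
  have hRℓ : ℓ ≤ R := le_max_left _ _
  have hRρ : -Real.log (ρ n) ≤ R := le_max_right _ _
  have hR0 : 0 < R := by linarith
  -- A negative `C n` has natural floor 0.
  have hKC : (K : ℝ) ≤ |C n| := by
    rcases le_total 0 (C n) with h | h
    · exact (Nat.floor_le h).trans (le_abs_self _)
    · have : K = 0 := Nat.floor_of_nonpos h
      rw [this]; simp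
  have hK0 : (0 : ℝ) ≤ K := Nat.cast_nonneg K
  have hKR : (K : ℝ) * R ≤ c * L := by
    have h1 : (K : ℝ) ≤ c * (L / R) := by
      refine hKC.trans ?_
      rw [Real.norm_eq_abs, Real.norm_eq_abs, abs_of_nonneg (a := L / R) (by positivity)] at hCn
      exact hCn
    rwa [← mul_div_assoc, le_div_iff₀ hR0] at h1
  have hKL : (K : ℝ) ≤ c * L := by nlinarith
  have hc2 : c ≤ 1 / 2 := min_le_right _ _
  have hcε : c ≤ ε / 48 := min_le_left _ _
  have hLn : L ≤ n := (Real.log_le_sub_one_of_pos hn0).trans (by linarith)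
  constructor
  · have : (2 * K : ℝ) ≤ n := by nlinarith
    exact_mod_cast this
  have hKℓ : (K : ℝ) * ℓ ≤ c * L := (mul_le_mul_of_nonneg_left hRℓ hK0).trans hKR
  have e1 : (4 : ℝ) ^ K ≤ Real.exp (c * L) := by
    rw [← Real.exp_log (show (0 : ℝ) < 4 by norm_num), ← Real.exp_nat_mul]
    exact Real.exp_le_exp.2 ((mul_le_mul_of_nonneg_left hℓ4 hK0).trans hKℓ)
  -- The base is at most `4L ≤ exp(2 log L)`, since `4 ≤ L`.
  have e2 : (4 * K : ℝ) ^ (4 * K) ≤ Real.exp (8 * (c * L)) := by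
    have h1 : (4 * K : ℝ) ≤ 4 * L := by nlinarith
    have h2 : (4 * L : ℝ) ≤ Real.exp (2 * ℓ) := by
      rw [two_mul, Real.exp_add]
      have h3 : Real.exp ℓ = L := Real.exp_log (by linarith)
      have h4 : (4 : ℝ) ≤ Real.exp ℓ := by
        rw [← Real.exp_log (show (0 : ℝ) < 4 by norm_num)]; exact Real.exp_le_exp.2 hℓ4
      nth_rewrite 1 [← h3]
      exact mul_le_mul_of_nonneg_right h4 (Real.exp_pos _).le
    refine (pow_le_pow_left₀ (by positivity) (h1.trans h2) _).trans ?_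
    rw [← Real.exp_nat_mul]
    refine Real.exp_le_exp.2 ?_
    push_cast
    linarith
  have e3 : Real.exp (-(2 * (c * L))) ≤ (ρ n : ℝ) ^ (2 * K) := by
    rw [← Real.exp_log (hρ n), ← Real.exp_nat_mul]
    refine Real.exp_le_exp.2 ?_
    push_cast
    have := mul_le_mul_of_nonneg_left hRρ hK0
    linarith
  have e4 : Real.exp (-(c * L)) ≤ δ ^ K := by
    rw [← Real.exp_log hδ, ← Real.exp_nat_mul]
    refine Real.exp_le_exp.2 ?_
    have := mul_le_mul_of_nonneg_left hℓδ hK0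
    linarith
  have e5 : (n : ℝ) ^ (ε / 2) = Real.exp (L * (ε / 2)) := Real.rpow_def_of_pos hn0 _
  have e6 : Real.exp (-(L * (ε / 4))) ≤ η := by
    rw [← Real.exp_log hη]
    refine Real.exp_le_exp.2 ?_
    rw [div_le_iff₀ (by positivity)] at hLη
    linarith
  calc (4 : ℝ) ^ K * (4 * K : ℝ) ^ (4 * K)
      ≤ Real.exp (c * L) * Real.exp (8 * (c * L)) := by gcongr
    _ ≤ Real.exp (-(L * (ε / 4))) * Real.exp (-(2 * (c * L)))
        * (Real.exp (L * (ε / 2)) * Real.exp (-(c * L))) := by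
        simp only [← Real.exp_add]
        refine Real.exp_le_exp.2 ?_
        have := mul_le_mul_of_nonneg_right hcε (show 0 ≤ L by linarith)
        nlinarith
    _ ≤ _ := by
        rw [e5]
        have hρK : 0 ≤ η * (ρ n : ℝ) ^ (2 * K) := mul_nonneg hη.le (pow_nonneg (hρ n).le _)
        gcongr

/-! ### The test -/

/-- Markov's inequality for `X ^ 2`. -/
lemma measureReal_ge_le {Ω : Type*} [MeasurableSpace Ω] [Finite Ω] [MeasurableSingletonClass Ω]
    (μ : Measure Ω) [IsProbabilityMeasure μ] (X : Ω → ℝ) {τ : ℝ} (hτ : 0 < τ) :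
    μ.real {ω | τ ≤ X ω} ≤ (∫ ω, X ω ^ 2 ∂μ) / τ ^ 2 := by
  rw [le_div_iff₀ (by positivity), mul_comm]
  refine le_trans ?_ (mul_meas_ge_le_integral_of_nonneg (.of_forall fun ω => sq_nonneg (X ω))
    Integrable.of_finite (τ ^ 2))
  refine mul_le_mul_of_nonneg_left (measureReal_mono fun ω hω => ?_) (by positivity)
  exact pow_le_pow_left₀ hτ.le hω 2

/-- Chebyshev's inequality: the preceding bound for the mean minus `X`. -/
lemma measureReal_lt_le {Ω : Type*} [MeasurableSpace Ω] [Finite Ω] [MeasurableSingletonClass Ω]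
    (μ : Measure Ω) [IsProbabilityMeasure μ] (X : Ω → ℝ) {τ : ℝ} (hτ : τ < ∫ ω, X ω ∂μ) :
    μ.real {ω | X ω < τ}
      ≤ ((∫ ω, X ω ^ 2 ∂μ) - (∫ ω, X ω ∂μ) ^ 2) / ((∫ ω, X ω ∂μ) - τ) ^ 2 := by
  set m := ∫ ω, X ω ∂μ with hm
  have h := measureReal_ge_le μ (fun ω => m - X ω) (sub_pos.2 hτ)
  have hint : ∫ ω, (m - X ω) ^ 2 ∂μ = (∫ ω, X ω ^ 2 ∂μ) - m ^ 2 := by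
    have h1 : ∀ ω, (m - X ω) ^ 2 = (X ω ^ 2 - 2 * m * X ω) + m ^ 2 := fun ω => by ring
    simp only [h1]
    rw [integral_add Integrable.of_finite Integrable.of_finite,
      integral_sub Integrable.of_finite Integrable.of_finite, integral_const_mul, ← hm]
    simp
    ring
  rw [hint] at h
  refine le_trans ?_ h
  refine measureReal_mono (fun ω hω => ?_)
  simp only [Set.mem_ofPred_eq] at hω ⊢
  linarith

lemma statistic_graphPair {n : ℕ} (p : I) (F : Finset Motif) (ω : Motif → ℝ)
    (π : Equiv.Perm (Fin n)) (x : Sym2 (Fin n) → Bool × Bool) :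
    statistic p F ω (graphPair π x) = statistic p F ω (graphPair 1 x) := by
  unfold statistic graphPair
  refine Finset.sum_congr rfl fun M _ => ?_
  simp only [injCount_map]

/-- The statistic does not depend on the latent permutation, hence neither does its law. -/
lemma altLaw_real_statistic_lt {n : ℕ} (p ρ : I) (F : Finset Motif) (ω : Motif → ℝ) (τ : ℝ) :
    (altLaw n p ρ).real {G | statistic p F ω G < τ}
      = (bitLaw n p ρ).real {x | statistic p F ω (graphPair 1 x) < τ} := by
  have h : ∀ π : Equiv.Perm (Fin n), altLawGiven p ρ π {G | statistic p F ω G < τ}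
      = bitLaw n p ρ {x | statistic p F ω (graphPair 1 x) < τ} := by
    intro π
    rw [altLawGiven, Measure.map_apply (measurable_of_finite _) (Set.toFinite _).measurableSet]
    congr 1
    ext x
    simp only [Set.mem_preimage, Set.mem_ofPred_eq, statistic_graphPair p F ω π x]
  rw [measureReal_def, measureReal_def, altLaw, Measure.smul_apply, Measure.finsetSum_apply,
    Finset.sum_congr rfl fun π _ => h π, Finset.sum_const, Finset.card_univ, nsmul_eq_mul,
    smul_eq_mul, ← mul_assoc, ENNReal.inv_mul_cancel (by simp [Fintype.card_ne_zero])
      (ENNReal.natCast_ne_top _), one_mul]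

/-! ### Motifs without edges -/

lemma not_adj_of_e_eq_zero {M : Motif} (he : M.e = 0) (a b : Fin M.v) : ¬ M.graph.Adj a b := by
  intro h
  have h0 : M.graph.edgeSet = ∅ := (Set.ncard_eq_zero (Set.toFinite _)).1 he
  have : s(a, b) ∈ M.graph.edgeSet := h
  simp [h0] at this

lemma subsingleton_of_e_eq_zero {M : Motif} (hM : M.graph.Connected) (he : M.e = 0) :
    Subsingleton (Fin M.v) := by
  refine ⟨fun a b => ?_⟩
  obtain ⟨w⟩ := hM.preconnected a b
  cases w with
  | nil => rfl
  | cons h _ => exact absurd h (not_adj_of_e_eq_zero he _ _)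

/-- A connected graph without edges is a single vertex. -/
lemma card_filter_e_eq_zero_le {F : Finset Motif} (hF : IsMotifFamily F)
    (hconn : ∀ M ∈ F, M.graph.Connected) : (F.filter fun M => ¬ 1 ≤ M.e).card ≤ 1 := by
  refine Finset.card_le_one.2 fun M hM N hN => ?_
  simp only [Finset.mem_filter, not_le, Nat.lt_one_iff] at hM hN
  refine hF M hM.1 N hN.1 ?_
  have := subsingleton_of_e_eq_zero (hconn M hM.1) hM.2
  have := subsingleton_of_e_eq_zero (hconn N hN.1) hN.2
  obtain ⟨a⟩ := (hconn M hM.1).nonempty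
  obtain ⟨b⟩ := (hconn N hN.1).nonempty
  exact ⟨⟨⟨fun _ => b, fun _ => a, fun _ => Subsingleton.elim _ _, fun _ => Subsingleton.elim _ _⟩,
    fun {x y} => iff_of_false (not_adj_of_e_eq_zero hN.2 _ _) (not_adj_of_e_eq_zero hM.2 _ _)⟩⟩

/-- The one-vertex motif must be discarded, since its copies are not determined by their edges. It
accounts for at most `ρ ^ 0 = 1` of the signal. -/
lemma signal_filter {ρ : I} {F : Finset Motif} (hF : IsMotifFamily F)
    (hconn : ∀ M ∈ F, M.graph.Connected) (hS : 400 ≤ ∑ M ∈ F, (ρ : ℝ) ^ (2 * M.e)) :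
    399 ≤ ∑ M ∈ F.filter (fun M => 1 ≤ M.e), (ρ : ℝ) ^ (2 * M.e) := by
  rw [← Finset.sum_filter_add_sum_filter_not F (fun M => 1 ≤ M.e)] at hS
  have h1 : ∑ M ∈ F.filter (fun M => ¬ 1 ≤ M.e), (ρ : ℝ) ^ (2 * M.e) ≤ 1 := by
    calc _ ≤ ∑ M ∈ F.filter (fun M => ¬ 1 ≤ M.e), (1 : ℝ) :=
          Finset.sum_le_sum fun M _ => pow_le_one₀ ρ.2.1 ρ.2.2
      _ = ((F.filter fun M => ¬ 1 ≤ M.e).card : ℝ) := by simp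
      _ ≤ 1 := by exact_mod_cast card_filter_e_eq_zero_le hF hconn
  linarith

/-- The test errs with small probability once overlapping quadruples are negligible. -/
lemma error_le {n : ℕ} {p ρ : I} {F : Finset Motif} (hF : IsMotifFamily F)
    (hconn : ∀ M ∈ F, M.graph.Connected) (he : ∀ M ∈ F, 1 ≤ M.e) (hp : 0 < (p : ℝ) * (1 - p))
    (hB : ∀ M ∈ F, 0 < coincidences n M M)
    (hη : ∀ M ∈ F, ∀ N ∈ F, overlapWeight n p M N
      ≤ 1 / 250 * ((ρ : ℝ) ^ (M.e + N.e) * ((coincidences n M M * ((p : ℝ) * (1 - p)) ^ M.e)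
        * (coincidences n N N * ((p : ℝ) * (1 - p)) ^ N.e))))
    {S : ℝ} (hS : S = ∑ M ∈ F, (ρ : ℝ) ^ (2 * M.e)) (hS' : 399 ≤ S) :
    (nullLaw n p).real {G | S / 2 ≤ statistic p F (weight n p ρ) G}
      + (altLaw n p ρ).real {G | statistic p F (weight n p ρ) G < S / 2} ≤ 0.05 := by
  have hS0 : 0 < S := by linarith
  have : IsProbabilityMeasure (nullLaw n p) := by unfold nullLaw; infer_instance
  have h0 := measureReal_ge_le (nullLaw n p) (statistic p F (weight n p ρ)) (half_pos hS0)
  rw [integral_statistic_sq_null hF hconn he hp hB, ← hS] at h0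
  have hm := integral_statistic_alt (ρ := ρ) hp hB
  have h2 := integral_statistic_sq_alt_le hF hconn he hp hB hη
  rw [← hS] at hm h2
  have h1 := measureReal_lt_le (bitLaw n p ρ)
    (fun x => statistic p F (weight n p ρ) (graphPair 1 x)) (τ := S / 2) (by rw [hm]; linarith)
  rw [hm] at h1
  rw [altLaw_real_statistic_lt]
  -- The null error is at most `4/S`, the other at most `8/S + 4η` with `η = 1/250`; in total
  -- `12/399 + 4/250 < 0.05`.
  have h3 : S / (S / 2) ^ 2 ≤ 4 / 399 := by
    rw [div_le_div_iff₀ (by positivity) (by norm_num)]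
    nlinarith
  have h4 : ((∫ x, statistic p F (weight n p ρ) (graphPair 1 x) ^ 2 ∂bitLaw n p ρ) - S ^ 2)
      / (S - S / 2) ^ 2 ≤ 8 / 399 + 4 / 250 := by
    rw [div_le_iff₀ (by nlinarith)]
    nlinarith
  norm_num at h3 h4 ⊢
  linarith

end MotifTest

/-! ### Choice of weights and threshold -/

theorem mainTheorem1
    (p ρ : ℕ → I) (C : ℕ → ℝ) (F : ℕ → Finset MotifTest.Motif) (δ : ℝ)
    (hp : ∀ n, 0 < (p n : ℝ)) (hδ : 0 < δ) (hp' : ∀ n, (p n : ℝ) ≤ 1 - δ)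
    (hρ : ∀ n, 0 < (ρ n : ℝ))
    (hF : ∀ n, MotifTest.IsMotifFamily (F n))
    (hadm : MotifTest.IsAdmissible p ρ C F) :
    ∀ᶠ n in atTop, ∃ (ω : MotifTest.Motif → ℝ) (τ : ℝ),
      (MotifTest.nullLaw n (p n)).real {G | τ ≤ MotifTest.statistic (p n) (F n) ω G}
        + (MotifTest.altLaw n (p n) (ρ n)).real {G | MotifTest.statistic (p n) (F n) ω G < τ}
        ≤ 0.05 := by
  obtain ⟨hC, ε, hε, hadm⟩ := hadm
  filter_upwards [hadm, eventually_ge_atTop 1,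
    MotifTest.eventually_size_bounds hρ hC hε hδ (show (0 : ℝ) < 1 / 250 by norm_num)]
    with n hn hn1 hsize
  obtain ⟨hK, hsmall⟩ := hsize
  set F' := (F n).filter fun M => 1 ≤ M.e with hF'
  have hsub : ∀ M ∈ F', M ∈ F n := fun M hM => (Finset.mem_filter.1 hM).1
  have he : ∀ M ∈ F', 1 ≤ M.e := fun M hM => (Finset.mem_filter.1 hM).2
  have hconn : ∀ M ∈ F', M.graph.Connected := fun M hM => hn.connected M (hsub M hM)
  have hv : ∀ M ∈ F', M.v ≤ ⌊C n⌋₊ := fun M hM => Nat.le_floor (hn.size_le M (hsub M hM)).1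
  have heK : ∀ M ∈ F', M.e ≤ ⌊C n⌋₊ := fun M hM => Nat.le_floor (hn.size_le M (hsub M hM)).2
  have hs : 0 < (p n : ℝ) * (1 - p n) := mul_pos (hp n) (by linarith [hp' n])
  -- Weight zero on the one-vertex motif turns the statistic of `F n` into that of `F'`.
  refine ⟨fun M => if 1 ≤ M.e then MotifTest.weight n (p n) (ρ n) M else 0,
    (∑ M ∈ F', (ρ n : ℝ) ^ (2 * M.e)) / 2, ?_⟩
  have hstat : ∀ G : SimpleGraph (Fin n) × SimpleGraph (Fin n), MotifTest.statistic (p n) (F n)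
      (fun M => if 1 ≤ M.e then MotifTest.weight n (p n) (ρ n) M else 0) G
      = MotifTest.statistic (p n) F' (MotifTest.weight n (p n) (ρ n)) G := by
    intro G
    simp only [MotifTest.statistic, hF', Finset.sum_filter, ite_mul, zero_mul]
  simp only [hstat]
  exact MotifTest.error_le (fun M hM N hN => hF n M (hsub M hM) N (hsub N hN)) hconn he hs
    (fun M hM => MotifTest.coincidences_pos M hn1 (hv M hM) hK)
    (fun M hM N hN => MotifTest.overlapWeight_le_mul hδ (hp' n) hn1 hε.le (by norm_num)
      (heK M hM) (heK N hN) (hv M hM) (hv N hN) hK (hconn M hM) (hconn N hN) (he M hM) (he N hN)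
      (hn.subgraph M (hsub M hM)) hsmall)
    rfl (MotifTest.signal_filter (hF n) hn.connected hn.signal)
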